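/- Let $K$ be a number field, let $f\in\mathcal O_K[X]$ be a square-free monic polynomial of odd degree at least $3$, and let $\mathcal S$ be a finite set of nonzero prime ideals of $\mathcal O_K$ such that the ring of $\mathcal S$-integers $R=\mathcal O_{K,\mathcal S}$ is a PID. **Forms.** For a commutative ring $R'$, the form $[a,b,c]=ax^2+bxy+cy^2$ with $a,b,c\in R'$ is *primitive* if $a,b,c$ generate the unit ideal, and its discriminant is $b^2-4ac$. Two forms $q,q'$ are *equivalent* over $R'$ if $q'=\frac1{\det M}\,(q\circ M)$ for some $M\in\mathrm{GL}_2(R')$. For a form $q$ of discriminant $4f$ over $K[X]$, let $H_q\subseteq (K[X]/(4f))^\times$ be the set of invertible values modulo $4f$ of the forms equivalent to $q$; the genus map sends the class of $q$ to the coset $H_q$ of $H_0:=H_{[1,0,-f]}$, and $q$ is *in the principal genus* over $K[X]$ if it lies in the kernel, i.e. if $H_q=H_0$. **Density.** A *density* on $R$ is a map $\delta$ from the set of subsets of $R$ to $[0,1]$ such that $\delta(R)=1$; $\delta(P)\le\delta(Q)$ if $P\subseteq Q$; $\delta(P\cup Q)\le\delta(P)+\delta(Q)$; $\delta(\alpha+P)=\delta(P)$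 for all $\alpha\in R$; and $\delta(I)=1/|R/I|$ for every ideal $I$ of $R$ (read as $0$ if $R/I$ is infinite). Let $\delta$ be a density on $R$, and let $[A,2B,C]$ be a primitive form over $R[X]$ of discriminant $4f$, with $A$ coprime to $f$ in $K[X]$. Assume that $[A,2B,C]$ is not in the principal genus over $K[X]$. Then the group $R^\times/R^{\times 2}$ is finite, and for every $\varepsilon\in R^\times$ there is a root $\rho_\varepsilon$ of $f$ in an algebraic closure of $K$ such that $\varepsilon A(\rho_\varepsilon)$ is not a square in the ring of $\mathcal S_\varepsilon$-integers of $K(\rho_\varepsilon)$, where $\mathcal S_\varepsilon$ is the set of primes of $K(\rho_\varepsilon)$ above $\mathcal S$. For any choice of representatives $\varepsilon$ of $R^\times/R^{\times 2}$ and of such roots $\rho_\varepsilon$, let $\mathcal P_\varepsilon$ be the set of nonzero primes $\mathfrak p$ of $K(\rho_\varepsilon)$ that are not above $\mathcal S$, have inertia degree $1$ over $K$, and are inert in $K\big(\rho_\varepsilon,\sqrt{\varepsilon A(\rho_\varepsilon)}\big)$. Let $$\mathcal T_{triv}=\{n\in R : [A(n),2B(n),C(n)]\text{ is equivalent over } R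 \text{ to } [1,0,-f(n)]\}.$$ Then the (possibly infinite) products below converge, unconditionally, as limits of their finite partial products (the limit may be $0$), and $$\delta(\mathcal T_{triv})\ \le\ \sum_{\varepsilon\in R^\times/R^{\times2}}\ \prod_{\mathfrak p\in\mathcal P_\varepsilon}\Big(1-\frac1{N(\mathfrak p)}\Big).$$ -/

import Mathlib

open IsDedekindDomain NumberField Polynomial IntermediateField

/-- The binary quadratic form `[a, b, c] = a x² + b x y + c y²` with coefficients in `R`. -/
@[ext]
structure BinForm (R : Type*) where
  /-- coefficient of `x²` -/
  a : R
  /-- coefficient of `x y` -/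
  b : R
  /-- coefficient of `y²` -/
  c : R

namespace BinForm

/-- The value `q(x, y)`. -/
def eval {R : Type*} [CommRing R] (q : BinForm R) (x y : R) : R :=
  q.a * x ^ 2 + q.b * x * y + q.c * y ^ 2

/-- The discriminant `b² - 4ac`. -/
def disc {R : Type*} [CommRing R] (q : BinForm R) : R := q.b ^ 2 - 4 * q.a * q.c

/-- A form is primitive if its coefficients generate the unit ideal. -/
def IsPrimitive {R : Type*} [CommRing R] (q : BinForm R) : Prop :=
  Ideal.span {q.a, q.b, q.c} = ⊤

/-- Apply a ring homomorphism to the coefficients (base change, or specialization at `X = n`). -/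
def map {R R' : Type*} [CommRing R] [CommRing R'] (φ : R →+* R') (q : BinForm R) : BinForm R' :=
  ⟨φ q.a, φ q.b, φ q.c⟩

/-- The twisted action of `GL₂(R)` on forms, `M · q = (det M)⁻¹ (q ∘ M)`, on coefficients. -/
def twistedAct {R : Type*} [CommRing R] (M : GL (Fin 2) R) (q : BinForm R) : BinForm R :=
  let d : R := ((Matrix.GeneralLinearGroup.det M)⁻¹ : Rˣ)
  ⟨d * q.eval (M 0 0) (M 1 0),
   d * (2 * q.a * M 0 0 * M 0 1 + q.b * (M 0 0 * M 1 1 + M 0 1 * M 1 0) + 2 * q.c * M 1 0 * M 1 1),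
   d * q.eval (M 0 1) (M 1 1)⟩

theorem eval_twistedAct {R : Type*} [CommRing R] (M : GL (Fin 2) R) (q : BinForm R) (x y : R) :
    (twistedAct M q).eval x y = ((Matrix.GeneralLinearGroup.det M)⁻¹ : Rˣ) *
      q.eval (M 0 0 * x + M 0 1 * y) (M 1 0 * x + M 1 1 * y) := by
  simp only [twistedAct, eval]
  ring

/-- Twisted equivalence of forms over `R`. -/
def Equivalent {R : Type*} [CommRing R] (q q' : BinForm R) : Prop :=
  ∃ M : GL (Fin 2) R, q' = twistedAct M q

/-- The principal form `[1, 0, -f]` of discriminant `4f`. -/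
def principal {R : Type*} [CommRing R] (f : R) : BinForm R := ⟨1, 0, -f⟩

theorem disc_principal {R : Type*} [CommRing R] (f : R) : (principal f).disc = 4 * f := by
  simp only [disc, principal]
  ring

/-- `Val_Δ(q)`: the values of `q` on `R/ΔR` that are units of `R/ΔR`. -/
def vals {R : Type*} [CommRing R] (Δ : R) (q : BinForm R) : Set (R ⧸ Ideal.span {Δ})ˣ :=
  {u | ∃ x y : R ⧸ Ideal.span {Δ}, (u : R ⧸ Ideal.span {Δ}) = (q.map (Ideal.Quotient.mk _)).eval x y}

/-- `H_q`: the set of values in `(R/ΔR)ˣ` of the class of `q`, i.e. the union of `Val_Δ(q')`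
over all forms `q'` equivalent to `q`. -/
def classVals {R : Type*} [CommRing R] (Δ : R) (q : BinForm R) : Set (R ⧸ Ideal.span {Δ})ˣ :=
  ⋃ q' ∈ {q' : BinForm R | Equivalent q q'}, vals Δ q'

/-- A form of discriminant `4f` is in the principal genus. The genus map sends the class of `q` to
the coset `H_q` of `H_0 = H_{[1, 0, -f]}` in `(R/4fR)ˣ`, so its kernel consists of the classes
with `H_q = H_0`. -/
def InPrincipalGenus {R : Type*} [CommRing R] (f : R) (q : BinForm R) : Prop :=
  classVals (4 * f) q = classVals (4 * f) (principal f)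

end BinForm

/-- A density on a ring `R`: a normalized, monotone, finitely subadditive, translation invariant
map from subsets of `R` to `[0, 1]`, with `δ(I) = 1 / N(I)` for each ideal `I`, where
`N(I) = |R/I|`. If `R/I` is infinite, then `Nat.card (R ⧸ I) = 0` and the condition reads
`δ(I) = 0`, as it should. -/
structure IsDensity {R : Type*} [CommRing R] (δ : Set R → ℝ) : Prop where
  mem_Icc : ∀ P, δ P ∈ Set.Icc (0 : ℝ) 1
  univ : δ Set.univ = 1
  mono : ∀ P Q, P ⊆ Q → δ P ≤ δ Q
  union : ∀ P Q, δ (P ∪ Q) ≤ δ P + δ Q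
  translate : ∀ (α : R) (P : Set R), δ ((fun x => α + x) '' P) = δ P
  ideal : ∀ I : Ideal R, δ (I : Set R) = 1 / (Nat.card (R ⧸ I) : ℝ)

instance instNumberFieldAdjoinSimple (K : Type*) [Field K] [NumberField K]
    (ρ : AlgebraicClosure K) : NumberField K⟮ρ⟯ :=
  haveI : FiniteDimensional K K⟮ρ⟯ :=
    adjoin.finiteDimensional (Algebra.IsIntegral.isIntegral ρ)
  NumberField.of_module_finite K K⟮ρ⟯

/-- The set of primes of `L` lying over the primes of `K` in `S`. -/
def primesOver {K : Type*} [Field K] (S : Set (HeightOneSpectrum (𝓞 K)))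
    (L : Type*) [Field L] [Algebra K L] : Set (HeightOneSpectrum (𝓞 L)) :=
  {𝔭 | ∃ v ∈ S, 𝔭.asIdeal.LiesOver v.asIdeal}

/-- For `ρ` algebraic over `K` and `u` and `A` with `S`-integral coefficients, the element
`u A(ρ)` of `K(ρ)`. -/
noncomputable def valueAt {K : Type*} [Field K] [NumberField K] {S : Set (HeightOneSpectrum (𝓞 K))}
    (A : (S.integer K)[X]) (u : (S.integer K)ˣ) (ρ : AlgebraicClosure K) : K⟮ρ⟯ :=
  algebraMap (S.integer K) K⟮ρ⟯ u * aeval (AdjoinSimple.gen K ρ) A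

/-- `ρ` is a root of `f` such that `u A(ρ)` is not a square in the ring of `S'`-integers of `K(ρ)`,
where `S'` is the set of primes of `K(ρ)` above `S`. -/
def IsNonsquareRoot {K : Type*} [Field K] [NumberField K] {S : Set (HeightOneSpectrum (𝓞 K))}
    (f : (𝓞 K)[X]) (A : (S.integer K)[X]) (u : (S.integer K)ˣ) (ρ : AlgebraicClosure K) : Prop :=
  aeval ρ f = 0 ∧ ¬ ∃ y ∈ (primesOver S K⟮ρ⟯).integer K⟮ρ⟯, y ^ 2 = valueAt A u ρ

/-- For a number field `F` inside an algebraically closed field `Ω` and `d ∈ F`, the field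
`F(√d)`. -/
noncomputable abbrev sqrtExt {F Ω : Type*} [Field F] [Field Ω] [Algebra F Ω] (d : F) :
    IntermediateField F Ω :=
  IntermediateField.adjoin F {s : Ω | s ^ 2 = algebraMap F Ω d}

/-- The set of primes `𝔭` of `K(ρ)` not above `S`, of inertia degree one over `K`, and inert in
`K(ρ, √(u A(ρ)))`, i.e. generating a prime ideal there. -/
def inertPrimes {K : Type*} [Field K] [NumberField K] {S : Set (HeightOneSpectrum (𝓞 K))}
    (A : (S.integer K)[X]) (u : (S.integer K)ˣ) (ρ : AlgebraicClosure K) :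
    Set (HeightOneSpectrum (𝓞 K⟮ρ⟯)) :=
  {𝔭 | 𝔭 ∉ primesOver S K⟮ρ⟯ ∧
    𝔭.asIdeal.inertiaDeg (𝓞 K) = 1 ∧
    (𝔭.asIdeal.map (algebraMap (𝓞 K⟮ρ⟯)
      (𝓞 (sqrtExt (Ω := AlgebraicClosure K) (valueAt A u ρ))))).IsPrime}

/-- The set of `n` for which the specialization at `X = n` of the form `q`, of discriminant `4f`,
is equivalent to `[1, 0, -f(n)]`. -/
def trivialSpecializations {K : Type*} [Field K] [NumberField K]
    {S : Set (HeightOneSpectrum (𝓞 K))} (f : (𝓞 K)[X]) (q : BinForm (S.integer K)[X]) :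
    Set (S.integer K) :=
  {n | (q.map (evalRingHom n)).Equivalent (BinForm.principal (aeval n f))}

/-!
Say `[A, 2B, C]` has nontrivial genus. By the Chinese remainder theorem modulo `f`, for every
`S`-unit `ε` some root `ρ` of `f` makes `ε A(ρ)` a nonsquare. If the form at `n` is equivalent to
`[1, 0, -f(n)]`, then `u A(n) = x² - f(n) y²` for some `S`-unit `u`, and only the class of `u`
modulo squares matters. Let `𝔭` be a prime of `K(ρ)` of degree one over `K`, inert in
`K(ρ, √(u A(ρ)))`. If `n ≡ ρ` modulo `𝔭`, then `u A(ρ) ≡ x²` modulo `𝔭`, contradicting inertness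
for all but finitely many `𝔭`; so `n` avoids a residue class modulo `𝔭`. Comparing the poles at `1`
of the Dedekind zeta functions of `K(ρ)` and of the quadratic extension shows that `∑ 1 / N(𝔭)` over
these `𝔭` diverges, so the density of such `n` is zero.
-/

section EulerProduct

open scoped ENNReal

variable {R : Type*} [CommRing R] [IsDedekindDomain R]

/-- The nonzero ideals all of whose prime divisors lie in `T`. -/
def idealsSupportedOn (T : Set (HeightOneSpectrum R)) : Set (Ideal R) :=
  {I | I ≠ ⊥ ∧ ∀ v : HeightOneSpectrum R, v.asIdeal ∣ I → v ∈ T}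

theorem idealsSupportedOn_empty : idealsSupportedOn (∅ : Set (HeightOneSpectrum R)) = {1} := by
  ext I
  constructor
  · rintro ⟨h0, h⟩
    by_contra hI
    obtain ⟨M, hM, hIM⟩ := Ideal.exists_le_maximal I (by simpa using hI)
    exact h ⟨M, hM.isPrime, fun hb => h0 (le_bot_iff.mp (hb ▸ hIM))⟩ (Ideal.dvd_iff_le.mpr hIM)
  · rintro rfl
    exact ⟨one_ne_zero, fun v hv => (v.prime.not_isUnit (isUnit_of_dvd_one hv)).elim⟩

theorem eq_of_asIdeal_dvd_asIdeal {v w : HeightOneSpectrum R} (h : v.asIdeal ∣ w.asIdeal) :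
    v = w :=
  HeightOneSpectrum.ext (associated_iff_eq.mp ((v.prime.dvd_prime_iff_associated w.prime).mp h))

theorem pow_mul_mem_idealsSupportedOn_insert {T : Set (HeightOneSpectrum R)}
    (v : HeightOneSpectrum R) (k : ℕ) {I : Ideal R} (hI : I ∈ idealsSupportedOn T) :
    v.asIdeal ^ k * I ∈ idealsSupportedOn (insert v T) := by
  refine ⟨mul_ne_zero (pow_ne_zero _ v.ne_bot) hI.1, fun w hw => ?_⟩
  rcases w.prime.dvd_or_dvd hw with h | h
  · exact Or.inl (eq_of_asIdeal_dvd_asIdeal (w.prime.dvd_of_dvd_pow h))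
  · exact Or.inr (hI.2 w h)

theorem exists_pow_mul_eq_of_mem_idealsSupportedOn_insert {T : Set (HeightOneSpectrum R)}
    {v : HeightOneSpectrum R} {I : Ideal R} (hI : I ∈ idealsSupportedOn (insert v T)) :
    ∃ k, ∃ J ∈ idealsSupportedOn T, v.asIdeal ^ k * J = I := by
  obtain ⟨J, hIJ, hJ⟩ :=
    (FiniteMultiplicity.of_prime_left v.prime hI.1).exists_eq_pow_mul_and_not_dvd
  refine ⟨_, J, ⟨?_, fun w hw => ?_⟩, hIJ.symm⟩
  · rintro rfl
    exact hJ (dvd_zero _)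
  · rcases hI.2 w (hIJ ▸ hw.mul_left _) with rfl | h
    · exact (hJ hw).elim
    · exact h

theorem le_of_pow_mul_eq_pow_mul {M : Type*} [CommMonoidWithZero M] [IsCancelMulZero M]
    {p a b : M} {k l : ℕ} (hp : p ≠ 0) (hb : ¬ p ∣ b) (h : p ^ k * a = p ^ l * b) : k ≤ l := by
  by_contra! hkl
  obtain ⟨m, rfl⟩ := Nat.exists_eq_add_of_lt hkl
  rw [add_assoc, pow_add, mul_assoc] at h
  exact hb ⟨p ^ m * a, by rw [← mul_left_cancel₀ (pow_ne_zero l hp) h, pow_succ', mul_assoc]⟩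

theorem eq_and_eq_of_pow_mul_eq_pow_mul {M : Type*} [CommMonoidWithZero M] [IsCancelMulZero M]
    {p a b : M} {k l : ℕ} (hp : p ≠ 0) (ha : ¬ p ∣ a) (hb : ¬ p ∣ b)
    (h : p ^ k * a = p ^ l * b) : k = l ∧ a = b := by
  obtain rfl : k = l :=
    le_antisymm (le_of_pow_mul_eq_pow_mul hp hb h) (le_of_pow_mul_eq_pow_mul hp ha h.symm)
  exact ⟨rfl, mul_left_cancel₀ (pow_ne_zero k hp) h⟩

theorem bijective_pow_mul_idealsSupportedOn {T : Set (HeightOneSpectrum R)}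
    {v : HeightOneSpectrum R} (hv : v ∉ T) :
    Function.Bijective fun p : ℕ × idealsSupportedOn T =>
      (⟨v.asIdeal ^ p.1 * p.2, pow_mul_mem_idealsSupportedOn_insert v p.1 p.2.2⟩ :
        idealsSupportedOn (insert v T)) := by
  constructor
  · rintro ⟨k, I, hI⟩ ⟨l, J, hJ⟩ h
    obtain ⟨rfl, rfl⟩ := eq_and_eq_of_pow_mul_eq_pow_mul v.ne_bot (fun h => hv (hI.2 v h))
      (fun h => hv (hJ.2 v h)) (congrArg Subtype.val h)
    rfl
  · rintro ⟨I, hI⟩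
    obtain ⟨k, J, hJ, rfl⟩ := exists_pow_mul_eq_of_mem_idealsSupportedOn_insert hI
    exact ⟨⟨k, J, hJ⟩, rfl⟩

theorem tsum_idealsSupportedOn (w : Ideal R →* ℝ≥0∞) (T : Finset (HeightOneSpectrum R)) :
    ∑' I : idealsSupportedOn (T : Set (HeightOneSpectrum R)), w I =
      ∏ v ∈ T, (1 - w v.asIdeal)⁻¹ := by
  classical
  induction T using Finset.induction with
  | empty =>
    rw [Finset.coe_empty, idealsSupportedOn_empty]
    simp [-Ideal.one_eq_top]
  | insert v T hv ih =>
    rw [Finset.prod_insert hv, ← ih, Finset.coe_insert, ← ENNReal.tsum_geometric,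
      ← ENNReal.tsum_mul_right,
      ← (Equiv.ofBijective _ (bijective_pow_mul_idealsSupportedOn (by simpa using hv))).tsum_eq,
      ENNReal.tsum_prod']
    simp [ENNReal.tsum_mul_left]

theorem finite_setOf_asIdeal_dvd_of_mem (s : Finset {I : Ideal R // I ≠ ⊥}) :
    {v : HeightOneSpectrum R | ∃ I ∈ s, v.asIdeal ∣ I.1}.Finite := by
  have : {v : HeightOneSpectrum R | ∃ I ∈ s, v.asIdeal ∣ I.1} =
      ⋃ I ∈ s, {v : HeightOneSpectrum R | v.asIdeal ∣ I.1} := by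
    ext
    simp
  exact this ▸ s.finite_toSet.biUnion fun I _ => Ideal.finite_factors I.2

/-- A finite set of ideals involves only finitely many primes, so the sum over all ideals is the
supremum of its restrictions to the ideals supported on a finite set of primes. -/
theorem tsum_eq_iSup_prod_inv_one_sub (w : Ideal R →* ℝ≥0∞) :
    ∑' I : {I : Ideal R // I ≠ ⊥}, w I =
      ⨆ T : Finset (HeightOneSpectrum R), ∏ v ∈ T, (1 - w v.asIdeal)⁻¹ := by
  simp_rw [← tsum_idealsSupportedOn]
  apply le_antisymm
  · rw [ENNReal.tsum_eq_iSup_sum]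
    refine iSup_le fun s => le_iSup_of_le (finite_setOf_asIdeal_dvd_of_mem s).toFinset ?_
    have hmem : Set.MapsTo Subtype.val (s : Set {I : Ideal R // I ≠ ⊥}) (idealsSupportedOn
        ((finite_setOf_asIdeal_dvd_of_mem s).toFinset : Set (HeightOneSpectrum R))) :=
      fun I hI => ⟨I.2, fun v hv => by simpa using ⟨I.1, ⟨I.2, hI⟩, hv⟩⟩
    rw [← s.tsum_subtype fun I => w I]
    exact ENNReal.tsum_comp_le_tsum_of_injective
      (hmem.restrict_inj.mpr Subtype.val_injective.injOn) fun I => w I.1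
  · exact iSup_le fun T => ENNReal.tsum_comp_le_tsum_of_injective
      (f := Set.inclusion fun I hI => hI.1) (Set.inclusion_injective _) fun I => w I.1

end EulerProduct

section DedekindZeta

open scoped ENNReal Topology
open Filter

/-- The completely multiplicative weight `I ↦ N(I)⁻ˢ` on ideals, for which the sum over the nonzero
ideals is `ζ_F(s)`. -/
noncomputable def normWeight (F : Type*) [Field F] [NumberField F] (s : ℝ) :
    Ideal (𝓞 F) →* ℝ≥0∞ where
  toFun I := ENNReal.ofReal ((Ideal.absNorm I : ℝ) ^ (-s))
  map_one' := by simp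
  map_mul' I J := by
    rw [← ENNReal.ofReal_mul (by positivity), map_mul, Nat.cast_mul,
      Real.mul_rpow (by positivity) (by positivity)]

variable (F : Type*) [Field F] [NumberField F]

theorem tendsto_sub_one_mul_dedekindZeta_re :
    Tendsto (fun s : ℝ ↦ (s - 1) * (dedekindZeta F s).re) (𝓝[>] 1)
      (𝓝 (dedekindZeta_residue F)) := by
  refine ((Complex.continuous_re.tendsto _).comp
    (tendsto_sub_one_mul_dedekindZeta_nhdsGT F)).congr fun s => ?_
  rw [Function.comp_apply, ← Complex.ofReal_one, ← Complex.ofReal_sub, Complex.re_ofReal_mul]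

/-- Since `(s - 1) ζ_F(s)` has a nonzero limit, `ζ_F(s)` is nonzero for `s` close to `1`, whereas a
divergent series has the junk value `0`. -/
theorem LSeriesSummable_card_absNorm_eq {s : ℝ} (hs : 1 < s) :
    LSeriesSummable (fun n ↦ (Nat.card {I : Ideal (𝓞 F) // Ideal.absNorm I = n} : ℂ)) s := by
  have hne : ∀ᶠ t : ℝ in 𝓝[>] 1, (t - 1) * dedekindZeta F t ≠ 0 :=
    (tendsto_sub_one_mul_dedekindZeta_nhdsGT F).eventually_ne
      (Complex.ofReal_ne_zero.mpr (dedekindZeta_residue_ne_zero F))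
  obtain ⟨t, ht, hts⟩ := (hne.and (Ioo_mem_nhdsGT hs)).exists
  have hsum : LSeriesSummable
      (fun n ↦ (Nat.card {I : Ideal (𝓞 F) // Ideal.absNorm I = n} : ℂ)) t := by
    by_contra h
    exact right_ne_zero_of_mul ht (tsum_eq_zero_of_not_summable h)
  exact hsum.of_re_le_re (by simpa using hts.2.le)

theorem LSeries_term_natCast_eq_ofReal (a : ℕ → ℕ) {s : ℝ} (hs : s ≠ 0) (n : ℕ) :
    LSeries.term (fun n => (a n : ℂ)) s n = ((a n * (n : ℝ) ^ (-s) : ℝ) : ℂ) := by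
  rcases eq_or_ne n 0 with rfl | hn
  · simp [Real.zero_rpow (neg_ne_zero.mpr hs)]
  · rw [LSeries.term_of_ne_zero hn, Real.rpow_neg n.cast_nonneg, div_eq_mul_inv]
    push_cast [Complex.ofReal_cpow n.cast_nonneg]
    rfl

theorem ofReal_dedekindZeta_re_eq_tsum {s : ℝ} (hs : 1 < s) :
    ENNReal.ofReal (dedekindZeta F s).re = ∑' n : ℕ, ENNReal.ofReal
      (Nat.card {I : Ideal (𝓞 F) // Ideal.absNorm I = n} * (n : ℝ) ^ (-s)) := by
  have hterm := funext (LSeries_term_natCast_eq_ofReal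
    (fun n => Nat.card {I : Ideal (𝓞 F) // Ideal.absNorm I = n}) (by linarith : s ≠ 0))
  have hsum := LSeriesSummable_card_absNorm_eq F hs
  rw [LSeriesSummable, hterm, Complex.summable_ofReal] at hsum
  rw [dedekindZeta, LSeries, hterm, ← Complex.ofReal_tsum, Complex.ofReal_re,
    ENNReal.ofReal_tsum_of_nonneg (fun n => by positivity) hsum]

theorem tsum_normWeight {s : ℝ} (hs : 1 < s) :
    ∑' I : {I : Ideal (𝓞 F) // I ≠ ⊥}, normWeight F s I =
      ENNReal.ofReal (dedekindZeta F s).re := by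
  have hsupp : Function.support (normWeight F s) ⊆ {I | I ≠ ⊥} := by
    rintro _ hI rfl
    exact hI (by simp [normWeight, Real.zero_rpow (by linarith : -s ≠ 0)])
  have hfiber (n : ℕ) : ∑' I : {I : Ideal (𝓞 F) // Ideal.absNorm I = n}, normWeight F s I =
      ENNReal.ofReal
        (Nat.card {I : Ideal (𝓞 F) // Ideal.absNorm I = n} * (n : ℝ) ^ (-s)) := by
    have : Finite {I : Ideal (𝓞 F) // Ideal.absNorm I = n} := Ideal.finite_setOfPred_absNorm_eq n
    have := Fintype.ofFinite {I : Ideal (𝓞 F) // Ideal.absNorm I = n}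
    have hw (I : {I : Ideal (𝓞 F) // Ideal.absNorm I = n}) :
        normWeight F s I = ENNReal.ofReal ((n : ℝ) ^ (-s)) := by
      simp [normWeight, I.2]
    simp only [hw, tsum_fintype, Finset.sum_const, Finset.card_univ, nsmul_eq_mul,
      Nat.card_eq_fintype_card, ENNReal.ofReal_mul (Nat.cast_nonneg _), ENNReal.ofReal_natCast]
  rw [ofReal_dedekindZeta_re_eq_tsum F hs]
  calc ∑' I : {I : Ideal (𝓞 F) // I ≠ ⊥}, normWeight F s I
      = ∑' I, normWeight F s I := tsum_subtype_eq_of_support_subset hsupp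
    _ = ∑' (n : ℕ) (I : {I : Ideal (𝓞 F) // Ideal.absNorm I = n}), normWeight F s I := by
        rw [← (Equiv.sigmaFiberEquiv Ideal.absNorm).tsum_eq, ENNReal.tsum_sigma']
        rfl
    _ = _ := tsum_congr hfiber

variable {F}

theorem two_le_absNorm_asIdeal (v : HeightOneSpectrum (𝓞 F)) :
    2 ≤ Ideal.absNorm v.asIdeal := by
  have h0 : Ideal.absNorm v.asIdeal ≠ 0 := fun h => v.ne_bot (Ideal.absNorm_eq_zero_iff.mp h)
  have h1 : Ideal.absNorm v.asIdeal ≠ 1 := fun h =>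
    v.isPrime.ne_top (Ideal.absNorm_eq_one_iff.mp h)
  omega

theorem absNorm_rpow_neg_le_rpow_neg (v : HeightOneSpectrum (𝓞 F)) {s t : ℝ} (h : s ≤ t) :
    (Ideal.absNorm v.asIdeal : ℝ) ^ (-t) ≤ (Ideal.absNorm v.asIdeal : ℝ) ^ (-s) :=
  Real.rpow_le_rpow_of_exponent_le
    (by exact_mod_cast one_le_two.trans (two_le_absNorm_asIdeal v)) (neg_le_neg h)

theorem absNorm_rpow_neg_le_half (v : HeightOneSpectrum (𝓞 F)) {s : ℝ} (hs : 1 ≤ s) :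
    (Ideal.absNorm v.asIdeal : ℝ) ^ (-s) ≤ 1 / 2 := by
  refine (absNorm_rpow_neg_le_rpow_neg v hs).trans ?_
  rw [Real.rpow_neg_one, ← one_div]
  exact one_div_le_one_div_of_le two_pos (by exact_mod_cast two_le_absNorm_asIdeal v)

theorem inv_one_sub_normWeight {s : ℝ} (hs : 1 ≤ s) (v : HeightOneSpectrum (𝓞 F)) :
    (1 - normWeight F s v.asIdeal)⁻¹ =
      ENNReal.ofReal (1 - (Ideal.absNorm v.asIdeal : ℝ) ^ (-s))⁻¹ := by
  rw [ENNReal.ofReal_inv_of_pos (by linarith [absNorm_rpow_neg_le_half v hs]),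
    ENNReal.ofReal_sub _ (by positivity), ENNReal.ofReal_one]
  rfl

theorem exp_le_inv_one_sub {x : ℝ} (hx : x < 1) : Real.exp x ≤ (1 - x)⁻¹ := by
  rw [← inv_inv (Real.exp x), ← Real.exp_neg]
  exact inv_anti₀ (by linarith) (Real.one_sub_le_exp_neg x)

theorem inv_one_sub_le_exp {x : ℝ} (hx : x ≤ 1 / 2) :
    (1 - x)⁻¹ ≤ Real.exp (x + 2 * x ^ 2) := by
  have hinv : (1 - x)⁻¹ = x / (1 - x) + 1 := by
    field_simp [show 1 - x ≠ 0 by linarith]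
    ring
  have hdiv : x / (1 - x) ≤ x + 2 * x ^ 2 := by
    rw [div_le_iff₀ (by linarith)]
    nlinarith [mul_nonneg (sq_nonneg x) (by linarith : 0 ≤ 1 - 2 * x)]
  exact hinv ▸ (Real.add_one_le_exp _).trans (Real.exp_le_exp.mpr hdiv)

theorem ofReal_exp_sum_absNorm_rpow_le {s : ℝ} (hs : 1 < s)
    (T : Finset (HeightOneSpectrum (𝓞 F))) :
    ENNReal.ofReal (Real.exp (∑ v ∈ T, (Ideal.absNorm v.asIdeal : ℝ) ^ (-s))) ≤
      ENNReal.ofReal (dedekindZeta F s).re := by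
  rw [← tsum_normWeight F hs, tsum_eq_iSup_prod_inv_one_sub, Real.exp_sum,
    ENNReal.ofReal_prod_of_nonneg fun _ _ => (Real.exp_pos _).le]
  refine le_iSup_of_le T (Finset.prod_le_prod' fun v _ => ?_)
  rw [inv_one_sub_normWeight hs.le]
  exact ENNReal.ofReal_le_ofReal
    (exp_le_inv_one_sub (by linarith [absNorm_rpow_neg_le_half v hs.le]))

theorem dedekindZeta_re_pos {s : ℝ} (hs : 1 < s) : 0 < (dedekindZeta F s).re :=
  ENNReal.ofReal_pos.mp ((ENNReal.ofReal_pos.mpr (Real.exp_pos _)).trans_le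
    (ofReal_exp_sum_absNorm_rpow_le hs ∅))

theorem sum_absNorm_rpow_le_log {s : ℝ} (hs : 1 < s) (T : Finset (HeightOneSpectrum (𝓞 F))) :
    ∑ v ∈ T, (Ideal.absNorm v.asIdeal : ℝ) ^ (-s) ≤ Real.log (dedekindZeta F s).re :=
  (Real.le_log_iff_exp_le (dedekindZeta_re_pos hs)).mpr
    ((ENNReal.ofReal_le_ofReal_iff (dedekindZeta_re_pos hs).le).mp
      (ofReal_exp_sum_absNorm_rpow_le hs T))

theorem summable_absNorm_rpow {s : ℝ} (hs : 1 < s) :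
    Summable fun v : HeightOneSpectrum (𝓞 F) => (Ideal.absNorm v.asIdeal : ℝ) ^ (-s) :=
  summable_of_sum_le (fun _ => by positivity) (sum_absNorm_rpow_le_log hs)

theorem tsum_absNorm_rpow_le_log_dedekindZeta {s : ℝ} (hs : 1 < s) :
    ∑' v : HeightOneSpectrum (𝓞 F), (Ideal.absNorm v.asIdeal : ℝ) ^ (-s) ≤
      Real.log (dedekindZeta F s).re :=
  (summable_absNorm_rpow hs).tsum_le_of_sum_le (sum_absNorm_rpow_le_log hs)

theorem log_dedekindZeta_le {s : ℝ} (hs : 1 < s) :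
    Real.log (dedekindZeta F s).re ≤
      ∑' v : HeightOneSpectrum (𝓞 F), (Ideal.absNorm v.asIdeal : ℝ) ^ (-s) +
        2 * ∑' v : HeightOneSpectrum (𝓞 F), (Ideal.absNorm v.asIdeal : ℝ) ^ (-2 : ℝ) := by
  rw [Real.log_le_iff_le_exp (dedekindZeta_re_pos hs),
    ← ENNReal.ofReal_le_ofReal_iff (Real.exp_pos _).le, ← tsum_normWeight F hs,
    tsum_eq_iSup_prod_inv_one_sub]
  refine iSup_le fun T => ?_
  have hfactor (v : HeightOneSpectrum (𝓞 F)) : (1 - normWeight F s v.asIdeal)⁻¹ ≤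
      ENNReal.ofReal (Real.exp ((Ideal.absNorm v.asIdeal : ℝ) ^ (-s) +
        2 * (Ideal.absNorm v.asIdeal : ℝ) ^ (-2 : ℝ))) := by
    rw [inv_one_sub_normWeight hs.le]
    refine ENNReal.ofReal_le_ofReal ((inv_one_sub_le_exp (absNorm_rpow_neg_le_half v hs.le)).trans
      (Real.exp_le_exp.mpr ?_))
    rw [← Real.rpow_mul_natCast (Nat.cast_nonneg _), neg_mul]
    refine add_le_add le_rfl (mul_le_mul_of_nonneg_left ?_ zero_le_two)
    exact absNorm_rpow_neg_le_rpow_neg v (by push_cast; linarith)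
  refine (Finset.prod_le_prod' fun v _ => hfactor v).trans ?_
  rw [← ENNReal.ofReal_prod_of_nonneg fun _ _ => (Real.exp_pos _).le, ← Real.exp_sum,
    Finset.sum_add_distrib, ← Finset.mul_sum]
  gcongr
  · exact (summable_absNorm_rpow hs).sum_le_tsum _ fun _ _ => by positivity
  · exact (summable_absNorm_rpow one_lt_two).sum_le_tsum _ fun _ _ => by positivity

theorem two_mul_tsum_compl_le_of_nontrivial {F' : Type*} [Field F'] [NumberField F']
    {D : Set (HeightOneSpectrum (𝓞 F))} (u : HeightOneSpectrum (𝓞 F') → HeightOneSpectrum (𝓞 F))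
    (h : ∀ v ∉ D,
      {w | u w = v ∧ Ideal.absNorm w.asIdeal = Ideal.absNorm v.asIdeal}.Nontrivial)
    {s : ℝ} (hs : 1 < s) :
    2 * ∑' v : ↥Dᶜ, (Ideal.absNorm v.1.asIdeal : ℝ) ^ (-s) ≤
      ∑' w : HeightOneSpectrum (𝓞 F'), (Ideal.absNorm w.asIdeal : ℝ) ^ (-s) := by
  choose w₁ hw₁ w₂ hw₂ hne using fun v : ↥Dᶜ => h v v.2
  have hinj : Function.Injective (Sum.elim w₁ w₂) := by
    refine Function.Injective.sumElim (fun v v' e => ?_) (fun v v' e => ?_) fun v v' e => ?_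
    · exact Subtype.ext ((hw₁ v).1.symm.trans (e ▸ (hw₁ v').1))
    · exact Subtype.ext ((hw₂ v).1.symm.trans (e ▸ (hw₂ v').1))
    · obtain rfl : v = v' := Subtype.ext ((hw₁ v).1.symm.trans (e ▸ (hw₂ v').1))
      exact hne v e
  have hsum : Summable fun v : ↥Dᶜ => (Ideal.absNorm v.1.asIdeal : ℝ) ^ (-s) :=
    (summable_absNorm_rpow hs).subtype _
  have hpair := HasSum.sum (f := fun x => (Ideal.absNorm (Sum.elim w₁ w₂ x).asIdeal : ℝ) ^ (-s))
    (by simpa [Function.comp_def, (hw₁ _).2] using hsum.hasSum)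
    (by simpa [Function.comp_def, (hw₂ _).2] using hsum.hasSum)
  rw [two_mul, ← hpair.tsum_eq]
  exact tsum_comp_le_tsum_of_inj (summable_absNorm_rpow hs) (fun _ => by positivity) hinj

theorem exists_sq_dedekindZeta_le_of_nontrivial {F' : Type*} [Field F'] [NumberField F']
    {D : Set (HeightOneSpectrum (𝓞 F))} (u : HeightOneSpectrum (𝓞 F') → HeightOneSpectrum (𝓞 F))
    (h : ∀ v ∉ D,
      {w | u w = v ∧ Ideal.absNorm w.asIdeal = Ideal.absNorm v.asIdeal}.Nontrivial)
    (hD : Summable fun v : D => 1 / (Ideal.absNorm v.1.asIdeal : ℝ)) :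
    ∃ c, ∀ s : ℝ, 1 < s → (dedekindZeta F s).re ^ 2 ≤ c * (dedekindZeta F' s).re := by
  refine ⟨Real.exp (2 * ∑' v : D, 1 / (Ideal.absNorm v.1.asIdeal : ℝ) +
    4 * ∑' v : HeightOneSpectrum (𝓞 F), (Ideal.absNorm v.asIdeal : ℝ) ^ (-2 : ℝ)),
    fun s hs => ?_⟩
  have hsum := summable_absNorm_rpow (F := F) hs
  have hDs : ∑' v : D, (Ideal.absNorm v.1.asIdeal : ℝ) ^ (-s) ≤
      ∑' v : D, 1 / (Ideal.absNorm v.1.asIdeal : ℝ) :=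
    (hsum.subtype D).tsum_le_tsum (fun v => by
      rw [one_div, ← Real.rpow_neg_one]
      exact absNorm_rpow_neg_le_rpow_neg v.1 hs.le) hD
  have hsplit := hsum.tsum_subtype_add_tsum_subtype_compl D
  rw [← Real.log_le_log_iff (pow_pos (dedekindZeta_re_pos hs) 2)
    (mul_pos (Real.exp_pos _) (dedekindZeta_re_pos hs)), Real.log_pow,
    Real.log_mul (Real.exp_pos _).ne' (dedekindZeta_re_pos hs).ne', Real.log_exp]
  push_cast
  linarith [log_dedekindZeta_le (F := F) hs, tsum_absNorm_rpow_le_log_dedekindZeta (F := F') hs,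
    two_mul_tsum_compl_le_of_nontrivial u h hs]

/-- `ζ_F²` has a double pole at `1` and `ζ_{F'}` a simple one. -/
theorem not_forall_sq_dedekindZeta_le (F F' : Type*) [Field F] [NumberField F] [Field F']
    [NumberField F'] (c : ℝ) :
    ¬ ∀ s : ℝ, 1 < s → (dedekindZeta F s).re ^ 2 ≤ c * (dedekindZeta F' s).re := by
  intro h
  have hsub : Tendsto (fun s : ℝ => s - 1) (𝓝[>] 1) (𝓝 0) :=
    tendsto_nhdsWithin_of_tendsto_nhds (by simpa using (continuous_sub_right (1 : ℝ)).tendsto 1)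
  have hright := (hsub.mul (tendsto_sub_one_mul_dedekindZeta_re F')).const_mul c
  have hle : dedekindZeta_residue F ^ 2 ≤ c * (0 * dedekindZeta_residue F') := by
    refine le_of_tendsto_of_tendsto ((tendsto_sub_one_mul_dedekindZeta_re F).pow 2) hright ?_
    filter_upwards [self_mem_nhdsWithin] with s hs
    calc ((s - 1) * (dedekindZeta F s).re) ^ 2
        = (s - 1) ^ 2 * (dedekindZeta F s).re ^ 2 := mul_pow _ _ _
      _ ≤ (s - 1) ^ 2 * (c * (dedekindZeta F' s).re) :=
          mul_le_mul_of_nonneg_left (h s hs) (sq_nonneg _)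
      _ = c * ((s - 1) * ((s - 1) * (dedekindZeta F' s).re)) := by ring
  have := pow_pos (dedekindZeta_residue_pos F) 2
  linarith

theorem not_summable_of_nontrivial {F' : Type*} [Field F'] [NumberField F']
    {D : Set (HeightOneSpectrum (𝓞 F))} (u : HeightOneSpectrum (𝓞 F') → HeightOneSpectrum (𝓞 F))
    (h : ∀ v ∉ D,
      {w | u w = v ∧ Ideal.absNorm w.asIdeal = Ideal.absNorm v.asIdeal}.Nontrivial) :
    ¬ Summable fun v : D => 1 / (Ideal.absNorm v.1.asIdeal : ℝ) := fun hD =>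
  have ⟨c, hc⟩ := exists_sq_dedekindZeta_le_of_nontrivial u h hD
  not_forall_sq_dedekindZeta_le F F' c hc

end DedekindZeta

section PrimesAbove

variable {A B : Type*} [CommRing A] [IsDedekindDomain A] [CommRing B] [IsDedekindDomain B]
  [Algebra A B]

instance liesOver_asIdeal_under [Algebra.IsIntegral A B] (w : HeightOneSpectrum B) :
    w.asIdeal.LiesOver (w.under A).asIdeal :=
  Ideal.over_under _

theorem under_eq_of_liesOver [Algebra.IsIntegral A B] (v : HeightOneSpectrum A)
    (w : HeightOneSpectrum B) [w.asIdeal.LiesOver v.asIdeal] : w.under A = v :=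
  HeightOneSpectrum.ext (w.asIdeal.over_def v.asIdeal).symm

variable [Module.Finite A B]

theorem absNorm_under_pow_inertiaDeg [Module.Free ℤ A] [Module.Free ℤ B]
    (w : HeightOneSpectrum B) :
    Ideal.absNorm (w.under A).asIdeal ^ w.asIdeal.inertiaDeg A = Ideal.absNorm w.asIdeal :=
  Ideal.absNorm_pow_inertiaDeg _ _

theorem absNorm_under_eq_of_inertiaDeg_eq_one [Module.Free ℤ A] [Module.Free ℤ B]
    {w : HeightOneSpectrum B} (hw : w.asIdeal.inertiaDeg A = 1) :
    Ideal.absNorm (w.under A).asIdeal = Ideal.absNorm w.asIdeal := by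
  rw [← absNorm_under_pow_inertiaDeg (A := A) w, hw, pow_one]

omit [IsDedekindDomain A] [IsDedekindDomain B] in
theorem one_le_ramificationIdx_mul_inertiaDeg (w : HeightOneSpectrum B) :
    1 ≤ w.asIdeal.ramificationIdx A * w.asIdeal.inertiaDeg A :=
  Nat.mul_pos (w.asIdeal.ramificationIdx_pos A) (w.asIdeal.inertiaDeg_pos A)

variable [Module.IsTorsionFree A B]

theorem sum_ramificationIdx_mul_inertiaDeg_le {v : HeightOneSpectrum A}
    {T : Finset (HeightOneSpectrum B)} (hT : ∀ w ∈ T, w.under A = v) :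
    ∑ w ∈ T, w.asIdeal.ramificationIdx A * w.asIdeal.inertiaDeg A ≤ Module.finrank A B := by
  classical
  have hsub : T.image HeightOneSpectrum.asIdeal ⊆ (v.asIdeal.primesOver B).toFinset := by
    intro P hP
    obtain ⟨w, hw, rfl⟩ := Finset.mem_image.mp hP
    exact Set.mem_toFinset.mpr ⟨w.isPrime, hT w hw ▸ inferInstance⟩
  calc ∑ w ∈ T, w.asIdeal.ramificationIdx A * w.asIdeal.inertiaDeg A
      = ∑ P ∈ T.image HeightOneSpectrum.asIdeal, P.ramificationIdx A * P.inertiaDeg A :=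
        (Finset.sum_image (f := fun P : Ideal B => P.ramificationIdx A * P.inertiaDeg A)
          fun _ _ _ _ h => HeightOneSpectrum.ext h).symm
    _ ≤ ∑ P ∈ (v.asIdeal.primesOver B).toFinset, P.ramificationIdx A * P.inertiaDeg A :=
        Finset.sum_le_sum_of_subset hsub
    _ = Module.finrank A B := by
        rw [← Ideal.sum_ramification_inertia_eq_finrank v.asIdeal B]
        exact (Finset.sum_set_coe _).symm

theorem card_le_finrank_of_under_eq {v : HeightOneSpectrum A}
    {T : Finset (HeightOneSpectrum B)} (hT : ∀ w ∈ T, w.under A = v) :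
    T.card ≤ Module.finrank A B := by
  refine le_trans ?_ (sum_ramificationIdx_mul_inertiaDeg_le hT)
  rw [Finset.card_eq_sum_ones]
  exact Finset.sum_le_sum fun w _ => one_le_ramificationIdx_mul_inertiaDeg w

theorem inertiaDeg_eq_one_of_ne_of_under_eq (hdeg : Module.finrank A B = 2)
    {w w' : HeightOneSpectrum B} (hne : w ≠ w') (h : w'.under A = w.under A) :
    w.asIdeal.inertiaDeg A = 1 := by
  classical
  have hsum := sum_ramificationIdx_mul_inertiaDeg_le (A := A) (T := {w, w'}) (v := w.under A)
    (by simp [h])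
  rw [Finset.sum_pair hne, hdeg] at hsum
  have hw := one_le_ramificationIdx_mul_inertiaDeg (A := A) w
  have hw' := one_le_ramificationIdx_mul_inertiaDeg (A := A) w'
  exact Nat.eq_one_of_mul_eq_one_left (by omega :
    w.asIdeal.ramificationIdx A * w.asIdeal.inertiaDeg A = 1)

theorem map_under_eq_of_unique {w : HeightOneSpectrum B}
    (hunique : ∀ w' : HeightOneSpectrum B, w'.under A = w.under A → w' = w)
    (hram : w.asIdeal.ramificationIdx A = 1) :
    (w.under A).asIdeal.map (algebraMap A B) = w.asIdeal := by
  have hprimes : ((w.under A).asIdeal.primesOver B).toFinset = {w.asIdeal} := by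
    ext P
    rw [Set.mem_toFinset, Finset.mem_singleton]
    constructor
    · rintro ⟨hP, hPw⟩
      let w' : HeightOneSpectrum B :=
        ⟨P, hP, Ideal.ne_bot_of_liesOver_of_ne_bot (w.under A).ne_bot P⟩
      have : w'.asIdeal.LiesOver (w.under A).asIdeal := hPw
      exact congrArg HeightOneSpectrum.asIdeal (hunique w' (under_eq_of_liesOver _ _))
    · rintro rfl
      exact ⟨w.isPrime, inferInstance⟩
  rw [Ideal.map_algebraMap_eq_finsetProd_pow (w.under A).ne_bot, hprimes,
    Finset.prod_singleton, hram, pow_one]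

end PrimesAbove

section InertPrimes

variable {F F' : Type*} [Field F] [NumberField F] [Field F'] [NumberField F'] [Algebra F F']

variable (F F') in
theorem finite_ramificationIdx_ne_one :
    {w : HeightOneSpectrum (𝓞 F') | w.asIdeal.ramificationIdx (𝓞 F) ≠ 1}.Finite := by
  have h0 : differentIdeal (𝓞 F) (𝓞 F') ≠ ⊥ := differentIdeal_ne_bot
  refine (Ideal.finite_factors h0).subset fun w hw => ?_
  by_contra hdvd
  exact hw (Ideal.ramificationIdx_eq_one_iff.mpr (not_dvd_differentIdeal_iff.mp hdvd))

theorem nontrivial_or_isPrime_map_or_ramified (hdeg : Module.finrank F F' = 2)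
    (v : HeightOneSpectrum (𝓞 F)) :
    {w : HeightOneSpectrum (𝓞 F') |
      w.under (𝓞 F) = v ∧ Ideal.absNorm w.asIdeal = Ideal.absNorm v.asIdeal}.Nontrivial ∨
    (v.asIdeal.map (algebraMap (𝓞 F) (𝓞 F'))).IsPrime ∨
    ∃ w : HeightOneSpectrum (𝓞 F'), w.asIdeal.ramificationIdx (𝓞 F) ≠ 1 ∧ w.under (𝓞 F) = v := by
  obtain ⟨w, rfl⟩ : ∃ w : HeightOneSpectrum (𝓞 F'), w.under (𝓞 F) = v := by
    obtain ⟨P, hP, hPv⟩ : Nonempty (v.asIdeal.primesOver (𝓞 F')) := inferInstance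
    let w : HeightOneSpectrum (𝓞 F') := ⟨P, hP, Ideal.ne_bot_of_liesOver_of_ne_bot v.ne_bot P⟩
    have : w.asIdeal.LiesOver v.asIdeal := hPv
    exact ⟨w, under_eq_of_liesOver v w⟩
  by_cases hunique : ∀ w' : HeightOneSpectrum (𝓞 F'), w'.under (𝓞 F) = w.under (𝓞 F) → w' = w
  · by_cases hram : w.asIdeal.ramificationIdx (𝓞 F) = 1
    · exact Or.inr (Or.inl (map_under_eq_of_unique hunique hram ▸ w.isPrime))
    · exact Or.inr (Or.inr ⟨w, hram, rfl⟩)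
  · push Not at hunique
    obtain ⟨w', hw', hne⟩ := hunique
    have hdeg' : Module.finrank (𝓞 F) (𝓞 F') = 2 := by
      rw [← hdeg, IsFractionRing.finrank_eq (𝓞 F) F (𝓞 F') F']
    refine Or.inl ⟨w, ⟨rfl, ?_⟩, w', ⟨hw', ?_⟩, hne.symm⟩
    · exact (absNorm_under_eq_of_inertiaDeg_eq_one
        (inertiaDeg_eq_one_of_ne_of_under_eq hdeg' hne.symm hw')).symm
    · rw [← hw']
      exact (absNorm_under_eq_of_inertiaDeg_eq_one
        (inertiaDeg_eq_one_of_ne_of_under_eq hdeg' hne hw'.symm)).symm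

theorem summable_comp_of_card_fiber_le {α β : Type*} {u : β → α} {n : ℕ}
    (hu : ∀ a (T : Finset β), (∀ b ∈ T, u b = a) → T.card ≤ n) {g : α → ℝ} (hg : ∀ a, 0 ≤ g a)
    (h : Summable g) : Summable (g ∘ u) := by
  classical
  refine summable_of_sum_le (c := n * ∑' a, g a) (fun b => hg (u b)) fun T => ?_
  calc ∑ b ∈ T, g (u b) = ∑ a ∈ T.image u, ({b ∈ T | u b = a}.card : ℝ) * g a := by
        simp only [Finset.sum_comp g u, nsmul_eq_mul]
    _ ≤ ∑ a ∈ T.image u, n * g a := Finset.sum_le_sum fun a _ =>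
        mul_le_mul_of_nonneg_right
          (by exact_mod_cast hu a _ fun b hb => (Finset.mem_filter.mp hb).2) (hg a)
    _ = n * ∑ a ∈ T.image u, g a := (Finset.mul_sum _ _ _).symm
    _ ≤ n * ∑' a, g a :=
        mul_le_mul_of_nonneg_left (h.sum_le_tsum _ fun a _ => hg a) n.cast_nonneg

/-- A prime of degree at least two has at least the square of the norm of the prime below. -/
theorem summable_one_div_absNorm_inertiaDeg_ne_one (K F : Type*) [Field K] [NumberField K]
    [Field F] [NumberField F] [Algebra K F] :
    Summable fun v : {v : HeightOneSpectrum (𝓞 F) | v.asIdeal.inertiaDeg (𝓞 K) ≠ 1} =>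
      1 / (Ideal.absNorm v.1.asIdeal : ℝ) := by
  have hsq : Summable fun v : HeightOneSpectrum (𝓞 F) =>
      (Ideal.absNorm (v.under (𝓞 K)).asIdeal : ℝ) ^ (-2 : ℝ) :=
    summable_comp_of_card_fiber_le (fun _ _ => card_le_finrank_of_under_eq)
      (fun _ => by positivity) (summable_absNorm_rpow one_lt_two)
  refine (hsq.subtype _).of_nonneg_of_le (fun _ => by positivity) fun ⟨v, hv⟩ => ?_
  have hN := two_le_absNorm_asIdeal (v.under (𝓞 K))
  have hle : Ideal.absNorm (v.under (𝓞 K)).asIdeal ^ 2 ≤ Ideal.absNorm v.asIdeal := by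
    rw [← absNorm_under_pow_inertiaDeg (A := 𝓞 K) v]
    have := v.asIdeal.inertiaDeg_pos (𝓞 K)
    exact Nat.pow_le_pow_right (by omega) (by have : _ ≠ 1 := hv; omega)
  rw [Function.comp_apply, Real.rpow_neg (by positivity), Real.rpow_two, ← one_div]
  exact one_div_le_one_div_of_le (by positivity) (by exact_mod_cast hle)

theorem summable_subtype_of_subset_union {α : Type*} {f : α → ℝ} (hf : ∀ a, 0 ≤ f a)
    {r s t : Set α} (h : r ⊆ s ∪ t) (hs : Summable fun a : s => f a)
    (ht : Summable fun a : t => f a) : Summable fun a : r => f a := by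
  have hs := summable_subtype_iff_indicator.mp hs
  have ht := summable_subtype_iff_indicator.mp ht
  refine summable_subtype_iff_indicator.mpr ?_
  refine (hs.add ht).of_nonneg_of_le (fun a => Set.indicator_nonneg (fun a _ => hf a) a)
    fun a => ?_
  have hs0 : 0 ≤ s.indicator f a := Set.indicator_nonneg (fun a _ => hf a) a
  have ht0 : 0 ≤ t.indicator f a := Set.indicator_nonneg (fun a _ => hf a) a
  by_cases ha : a ∈ r
  · rw [Set.indicator_of_mem ha]
    rcases h ha with has | hat
    · simpa [has] using ht0
    · simpa [hat] using hs0
  · rw [Set.indicator_of_notMem ha]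
    exact add_nonneg hs0 ht0

theorem not_summable_subtype_of_finite {α : Type*} {f : α → ℝ} (hf : ∀ a, 0 ≤ f a)
    {s t r : Set α} (hr : r.Finite) (h : s ⊆ t ∪ r) (hs : ¬ Summable fun a : s => f a) :
    ¬ Summable fun a : t => f a :=
  fun ht => hs (summable_subtype_of_subset_union hf h ht (hr.summable f))

/-- The primes of `F` that split in `F'` have two primes of the same norm above them; those that
ramify or have degree at least two over `K` contribute a convergent sum. -/
theorem not_summable_one_div_absNorm_inert (K : Type*) [Field K] [NumberField K] [Algebra K F]
    (hdeg : Module.finrank F F' = 2) :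
    ¬ Summable fun v : {v : HeightOneSpectrum (𝓞 F) | v.asIdeal.inertiaDeg (𝓞 K) = 1 ∧
      (v.asIdeal.map (algebraMap (𝓞 F) (𝓞 F'))).IsPrime} =>
        1 / (Ideal.absNorm v.1.asIdeal : ℝ) := by
  intro hinert
  let R : Set (HeightOneSpectrum (𝓞 F)) :=
    HeightOneSpectrum.under (𝓞 F) ''
      {w : HeightOneSpectrum (𝓞 F') | w.asIdeal.ramificationIdx (𝓞 F) ≠ 1}
  have hram : Summable fun v : R => 1 / (Ideal.absNorm v.1.asIdeal : ℝ) :=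
    have := ((finite_ramificationIdx_ne_one F F').image (HeightOneSpectrum.under (𝓞 F))).to_subtype
    .of_finite
  have hpos (v : HeightOneSpectrum (𝓞 F)) : 0 ≤ 1 / (Ideal.absNorm v.asIdeal : ℝ) := by
    positivity
  have hexc := summable_subtype_of_subset_union hpos subset_rfl hram
    (summable_one_div_absNorm_inertiaDeg_ne_one K F)
  let D : Set (HeightOneSpectrum (𝓞 F)) := {v | ¬ {w : HeightOneSpectrum (𝓞 F') |
    w.under (𝓞 F) = v ∧ Ideal.absNorm w.asIdeal = Ideal.absNorm v.asIdeal}.Nontrivial}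
  refine not_summable_of_nontrivial (D := D) (HeightOneSpectrum.under (𝓞 F))
    (fun v hv => not_not.mp hv) (summable_subtype_of_subset_union hpos (fun v hv => ?_) hinert hexc)
  rcases nontrivial_or_isPrime_map_or_ramified hdeg v with hsplit | hprime | ⟨w, hw⟩
  · exact absurd hsplit hv
  · by_cases hK : v.asIdeal.inertiaDeg (𝓞 K) = 1
    · exact Or.inl ⟨hK, hprime⟩
    · exact Or.inr (Or.inr hK)
  · exact Or.inr (Or.inl ⟨w, hw⟩)

end InertPrimes

theorem exists_finset_prod_one_sub_lt_of_not_summable {α : Type*} {f : α → ℝ}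
    (hf : ∀ a, f a ∈ Set.Icc 0 1) (h : ¬ Summable f) {ε : ℝ} (hε : 0 < ε) :
    ∃ T : Finset α, ∏ a ∈ T, (1 - f a) < ε := by
  obtain ⟨T, hT⟩ : ∃ T : Finset α, -Real.log ε < ∑ a ∈ T, f a := by
    by_contra! hle
    exact h (summable_of_sum_le (fun a => (hf a).1) hle)
  refine ⟨T, ?_⟩
  calc ∏ a ∈ T, (1 - f a) ≤ ∏ a ∈ T, Real.exp (-f a) :=
        Finset.prod_le_prod (fun a _ => sub_nonneg.mpr (hf a).2)
          fun a _ => Real.one_sub_le_exp_neg (f a)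
    _ = Real.exp (-∑ a ∈ T, f a) := by rw [← Real.exp_sum, Finset.sum_neg_distrib]
    _ < ε := by
        rw [← Real.lt_log_iff_exp_lt hε]
        linarith

theorem one_div_absNorm_mem_Icc {F : Type*} [Field F] [NumberField F]
    (v : HeightOneSpectrum (𝓞 F)) : 1 / (Ideal.absNorm v.asIdeal : ℝ) ∈ Set.Icc 0 1 := by
  have hN : (2 : ℝ) ≤ Ideal.absNorm v.asIdeal := by exact_mod_cast two_le_absNorm_asIdeal v
  exact ⟨by positivity, (div_le_one (by positivity)).mpr (by linarith)⟩

/-- At most `[F : K]` primes lie above each prime of `K`, so choosing one of them each time keeps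
the sum of `1 / N` divergent. -/
theorem exists_finset_injOn_under_prod_lt (K : Type*) {F : Type*} [Field K] [NumberField K]
    [Field F] [NumberField F] [Algebra K F] {G : Set (HeightOneSpectrum (𝓞 F))}
    (hG : ∀ v ∈ G, v.asIdeal.inertiaDeg (𝓞 K) = 1)
    (hsum : ¬ Summable fun v : G => 1 / (Ideal.absNorm v.1.asIdeal : ℝ)) {ε : ℝ} (hε : 0 < ε) :
    ∃ T : Finset G, Set.InjOn (fun v : G => v.1.under (𝓞 K)) T ∧
      ∏ v ∈ T, (1 - 1 / (Ideal.absNorm v.1.asIdeal : ℝ)) < ε := by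
  classical
  let under : G → HeightOneSpectrum (𝓞 K) := fun v => v.1.under (𝓞 K)
  have hN (v : G) : Ideal.absNorm (under v).asIdeal = Ideal.absNorm v.1.asIdeal :=
    absNorm_under_eq_of_inertiaDeg_eq_one (hG v.1 v.2)
  have hrange : ¬ Summable fun p : Set.range under => 1 / (Ideal.absNorm p.1.asIdeal : ℝ) := by
    refine fun h => hsum ?_
    have hfiber (p : Set.range under) (T : Finset G)
        (hT : ∀ v ∈ T, Set.rangeFactorization under v = p) :
        T.card ≤ Module.finrank (𝓞 K) (𝓞 F) := by
      rw [← Finset.card_map (Function.Embedding.subtype _)]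
      refine card_le_finrank_of_under_eq (v := p.1) fun w hw => ?_
      obtain ⟨v, hv, rfl⟩ := Finset.mem_map.mp hw
      exact congrArg Subtype.val (hT v hv)
    refine (summable_comp_of_card_fiber_le hfiber (fun p => by positivity) h).congr fun v => ?_
    exact congrArg (fun n : ℕ => 1 / (n : ℝ)) (hN v)
  obtain ⟨T, hT⟩ := exists_finset_prod_one_sub_lt_of_not_summable
    (fun p : Set.range under => one_div_absNorm_mem_Icc p.1) hrange hε
  have hsection (p : Set.range under) : under (Set.rangeSplitting under p) = p :=
    Set.apply_rangeSplitting under p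
  refine ⟨T.map ⟨_, Set.rangeSplitting_injective under⟩, fun v hv v' hv' h => ?_, ?_⟩
  · obtain ⟨p, -, rfl⟩ := Finset.mem_map.mp hv
    obtain ⟨p', -, rfl⟩ := Finset.mem_map.mp hv'
    exact congrArg (Set.rangeSplitting under)
      (Subtype.ext ((hsection p).symm.trans (h.trans (hsection p'))))
  · refine (Finset.prod_map ..).trans_lt (hT.trans_eq' (Finset.prod_congr rfl fun p _ => ?_))
    rw [← hsection p, hN]
    rfl

namespace IsDensity

variable {R : Type*} [CommRing R] {δ : Set R → ℝ}

theorem empty (hδ : IsDensity δ) [Infinite R] : δ ∅ = 0 := by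
  refine le_antisymm ((hδ.mono ∅ ((⊥ : Ideal R) : Set R) (Set.empty_subset _)).trans_eq ?_)
    (hδ.mem_Icc _).1
  rw [hδ.ideal, Nat.card_congr (RingEquiv.quotientBot R).toEquiv, Nat.card_eq_zero_of_infinite,
    Nat.cast_zero, div_zero]

theorem biUnion_le (hδ : IsDensity δ) [Infinite R] {ι : Type*} (s : Finset ι)
    (P : ι → Set R) : δ (⋃ i ∈ s, P i) ≤ ∑ i ∈ s, δ (P i) := by
  classical
  induction s using Finset.induction with
  | empty => simp [hδ.empty]
  | insert i s hi ih =>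
    rw [Finset.set_biUnion_insert, Finset.sum_insert hi]
    linarith [hδ.union (P i) (⋃ j ∈ s, P j)]

theorem preimage_singleton (hδ : IsDensity δ) {Q : Type*} [CommRing Q] {φ : R →+* Q}
    (hφ : Function.Surjective φ) (c : Q) : δ (φ ⁻¹' {c}) = 1 / (Nat.card Q : ℝ) := by
  obtain ⟨a, rfl⟩ := hφ c
  rw [← Nat.card_congr (RingHom.quotientKerEquivOfSurjective hφ).toEquiv,
    ← hδ.ideal (RingHom.ker φ), ← hδ.translate a (RingHom.ker φ : Set R), Set.image_add_left]
  congr 1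
  ext x
  rw [Set.mem_preimage, Set.mem_preimage, Set.mem_singleton_iff, SetLike.mem_coe, RingHom.mem_ker,
    map_add, map_neg, neg_add_eq_zero, eq_comm]

theorem preimage_le (hδ : IsDensity δ) [Infinite R] {Q : Type*} [CommRing Q] {φ : R →+* Q}
    (hφ : Function.Surjective φ) (C : Finset Q) : δ (φ ⁻¹' C) ≤ C.card / (Nat.card Q : ℝ) := by
  calc δ (φ ⁻¹' C) = δ (⋃ c ∈ C, φ ⁻¹' {c}) := by
        rw [← Set.biUnion_preimage_singleton]
        rfl
    _ ≤ ∑ c ∈ C, δ (φ ⁻¹' {c}) := hδ.biUnion_le C _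
    _ = C.card / (Nat.card Q : ℝ) := by
        rw [Finset.sum_congr rfl fun c _ => hδ.preimage_singleton hφ c, Finset.sum_const,
          nsmul_eq_mul, mul_one_div]

theorem le_prod_one_sub (hδ : IsDensity δ) [Infinite R] {ι : Type*} [Fintype ι]
    {P : ι → Ideal R} [∀ i, (P i).IsMaximal] (hinj : Function.Injective P)
    [∀ i, Finite (R ⧸ P i)] {X : Set R} (a : ι → R) (hX : ∀ n ∈ X, ∀ i, n - a i ∉ P i) :
    δ X ≤ ∏ i, (1 - 1 / (Nat.card (R ⧸ P i) : ℝ)) := by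
  classical
  have (i : ι) : Fintype (R ⧸ P i) := Fintype.ofFinite _
  let φ : R →+* ∀ i, R ⧸ P i := RingHom.pi fun i => Ideal.Quotient.mk (P i)
  have hφ : Function.Surjective φ := fun x => by
    have hcop : Pairwise (Function.onFun IsCoprime P) := fun i j hij =>
      Ideal.isCoprime_of_isMaximal (hinj.ne hij)
    obtain ⟨r, hr⟩ := Ideal.pi_quotient_surjective hcop x
    exact ⟨r, funext hr⟩
  let C : Finset (∀ i, R ⧸ P i) := Fintype.piFinset fun i => {Ideal.Quotient.mk (P i) (a i)}ᶜ
  have hXC : X ⊆ φ ⁻¹' C := fun n hn => Fintype.mem_piFinset.mpr fun i => by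
    rw [Finset.mem_compl, Finset.mem_singleton]
    exact fun h => hX n hn i (Ideal.Quotient.eq.mp h)
  calc δ X ≤ C.card / (Nat.card (∀ i, R ⧸ P i) : ℝ) :=
        (hδ.mono _ _ hXC).trans (hδ.preimage_le hφ C)
    _ = ∏ i, ((Nat.card (R ⧸ P i) - 1 : ℝ) / Nat.card (R ⧸ P i)) := by
        rw [Nat.card_pi, Finset.prod_div_distrib]
        simp only [C, Fintype.card_piFinset, Finset.card_compl, Finset.card_singleton,
          Nat.cast_prod, Nat.cast_pred Fintype.card_pos, Nat.card_eq_fintype_card]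
    _ = ∏ i, (1 - 1 / (Nat.card (R ⧸ P i) : ℝ)) := by
        refine Finset.prod_congr rfl fun i _ => ?_
        rw [sub_div, div_self (by exact_mod_cast Nat.card_pos.ne')]

end IsDensity

section Residues

theorem valuation_lt_one_of_valuation_sq_sub_sq_lt_one {L Γ₀ : Type*} [Field L]
    [LinearOrderedCommGroupWithZero Γ₀] {w : Valuation L Γ₀} {τ : L →+* L}
    (hτ : ∀ z, w z < 1 → w (τ z) < 1) (h2 : w 2 = 1) {x s : L} (hx : τ x = x) (hs : τ s = -s)
    (h : w (x ^ 2 - s ^ 2) < 1) : w s < 1 := by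
  have hfactors : w (x + s) < 1 ∧ w (x - s) < 1 := by
    rw [sq_sub_sq, map_mul] at h
    rcases lt_or_lt_of_mul_lt_mul (h.trans_eq (mul_one 1).symm) with hadd | hsub
    · exact ⟨hadd, by simpa [hx, hs, ← sub_eq_add_neg] using hτ _ hadd⟩
    · exact ⟨by simpa [hx, hs] using hτ _ hsub, hsub⟩
  have h2s : w (2 * s) < 1 := by
    rw [show 2 * s = (x + s) - (x - s) by ring]
    exact Valuation.map_sub_lt w hfactors.1 hfactors.2
  rwa [map_mul, h2, one_mul] at h2s

theorem valuation_lt_one_iff_valuation_algebraMap_lt_one {A B K L : Type*} [CommRing A]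
    [IsDedekindDomain A] [CommRing B] [IsDedekindDomain B] [Field K] [Field L] [Algebra A K]
    [IsFractionRing A K] [Algebra B L] [IsFractionRing B L] [Algebra A B] [Algebra K L]
    [Algebra A L] [IsScalarTower A B L] [IsScalarTower A K L] [Module.IsTorsionFree A B]
    (v : HeightOneSpectrum A) (w : HeightOneSpectrum B) [w.asIdeal.LiesOver v.asIdeal] {x : K} :
    w.valuation L (algebraMap K L x) < 1 ↔ v.valuation K x < 1 := by
  rw [← HeightOneSpectrum.valuation_liesOver L v w]
  refine pow_lt_one_iff_of_nonneg zero_le ?_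
  exact Ideal.IsDedekindDomain.ramificationIdx'_ne_zero_of_liesOver w.asIdeal v.ne_bot

theorem valuation_map_lt_one_of_comap_eq {B L : Type*} [CommRing B] [IsDedekindDomain B] [Field L]
    [Algebra B L] [IsFractionRing B L] {w : HeightOneSpectrum B} {σ : B →+* B} {τ : L →+* L}
    (hστ : ∀ b, τ (algebraMap B L b) = algebraMap B L (σ b)) (hσ : w.asIdeal.comap σ = w.asIdeal)
    {z : L} (hz : w.valuation L z < 1) : w.valuation L (τ z) < 1 := by
  have hmem (b : B) : σ b ∈ w.asIdeal ↔ b ∈ w.asIdeal := by rw [← Ideal.mem_comap, hσ]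
  have hlt (b : B) : w.valuation L (algebraMap B L b) < 1 ↔ b ∈ w.asIdeal :=
    w.valuation_lt_one_iff_mem b
  obtain ⟨a, b, hab⟩ := w.exists_primeCompl_mul_eq_of_integer z hz.le
  have hb : w.valuation L (algebraMap B L b) = 1 := w.valuation_eq_one_iff_notMem.mpr b.2
  have hσb : w.valuation L (τ (algebraMap B L b)) = 1 :=
    hστ b ▸ w.valuation_eq_one_iff_notMem.mpr ((hmem b).not.mpr b.2)
  have ha : a ∈ w.asIdeal := by
    rwa [← hlt, ← hab, map_mul, hb, mul_one]
  have := (hlt _).mpr ((hmem a).mpr ha)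
  rwa [← hστ, ← hab, map_mul, map_mul, hσb, mul_one] at this

theorem exists_algEquiv_apply_eq_neg {F F' : Type*} [Field F] [Field F'] [Algebra F F']
    [FiniteDimensional F F'] [IsGalois F F'] {s : F'} {d : F} (hs : s ^ 2 = algebraMap F F' d)
    (hd : ¬ ∃ y : F, y ^ 2 = d) : ∃ τ : F' ≃ₐ[F] F', τ s = -s := by
  by_contra! hne
  have hfixed (τ : F' ≃ₐ[F] F') : τ s = s := by
    have h := congrArg τ hs
    rw [AlgEquiv.commutes, map_pow, ← hs] at h
    exact (sq_eq_sq_iff_eq_or_eq_neg.mp h).resolve_right (hne τ)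
  obtain ⟨y, hy⟩ := IntermediateField.mem_bot.mp ((IsGalois.mem_bot_iff_fixed s).mpr hfixed)
  exact hd ⟨y, (algebraMap F F').injective (by rw [map_pow, hy, hs])⟩

section

variable {F F' : Type*} [Field F] [NumberField F] [Field F'] [NumberField F'] [Algebra F F']

omit [NumberField F] in
theorem valuation_algEquiv_lt_one_of_asIdeal_eq_map {v : HeightOneSpectrum (𝓞 F)}
    {w : HeightOneSpectrum (𝓞 F')} (hw : w.asIdeal = v.asIdeal.map (algebraMap (𝓞 F) (𝓞 F')))
    (τ : F' ≃ₐ[F] F') {z : F'} (hz : w.valuation F' z < 1) : w.valuation F' (τ z) < 1 := by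
  let σ : 𝓞 F' ≃ₐ[𝓞 F] 𝓞 F' := RingOfIntegers.mapAlgEquiv τ
  have hcomap : w.asIdeal.comap (σ : 𝓞 F' →+* 𝓞 F') = w.asIdeal := by
    refine (w.isMaximal.eq_of_le (Ideal.comap_ne_top _ w.isPrime.ne_top) ?_).symm
    rw [← Ideal.map_le_iff_le_comap, hw, Ideal.map_map]
    exact (congrArg v.asIdeal.map σ.toAlgHom.comp_algebraMap).le
  exact valuation_map_lt_one_of_comap_eq (τ := τ) (fun b => rfl) hcomap hz

theorem one_le_valuation_sq_sub_of_isPrime_map [IsGalois F F'] {s : F'} {d : F}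
    (hs : s ^ 2 = algebraMap F F' d) (hd : ¬ ∃ y : F, y ^ 2 = d) {v : HeightOneSpectrum (𝓞 F)}
    (hv : (v.asIdeal.map (algebraMap (𝓞 F) (𝓞 F'))).IsPrime) (h2 : v.valuation F 2 = 1)
    (hvd : v.valuation F d = 1) (x : F) : 1 ≤ v.valuation F (x ^ 2 - d) := by
  by_contra! hlt
  let w : HeightOneSpectrum (𝓞 F') := ⟨_, hv, Ideal.map_ne_bot_of_ne_bot v.ne_bot⟩
  have : w.asIdeal.LiesOver v.asIdeal :=
    ⟨v.isMaximal.eq_of_le (Ideal.comap_ne_top _ hv.ne_top) Ideal.le_comap_map⟩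
  have hvw (r : F) := valuation_lt_one_iff_valuation_algebraMap_lt_one (L := F') v w (x := r)
  obtain ⟨τ, hτ⟩ := exists_algEquiv_apply_eq_neg hs hd
  have hws : w.valuation F' s < 1 := by
    refine valuation_lt_one_of_valuation_sq_sub_sq_lt_one (τ := τ)
      (fun z => valuation_algEquiv_lt_one_of_asIdeal_eq_map rfl τ) ?_ (τ.commutes x) hτ ?_
    · rw [← map_ofNat (algebraMap F F') 2, ← HeightOneSpectrum.valuation_liesOver F' v w, h2,
        one_pow]
    · rw [hs, ← map_pow, ← map_sub]
      exact (hvw _).mpr hlt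
  refine hvd.not_lt ((hvw d).mp ?_)
  rw [← hs, map_pow]
  exact pow_lt_one₀ zero_le hws two_ne_zero

end

theorem exists_sub_mem_of_inertiaDeg_eq_one {A B : Type*} [CommRing A] [IsDedekindDomain A]
    [CommRing B] [IsDedekindDomain B] [Algebra A B] [Algebra.IsIntegral A B]
    {v : HeightOneSpectrum B} (hv : v.asIdeal.inertiaDeg A = 1) (z : B) :
    ∃ a : A, algebraMap A B a - z ∈ v.asIdeal := by
  have := v.isMaximal
  have := (v.under A).isMaximal
  rw [Ideal.inertiaDeg_eq_of_isMaximal (v.under A).asIdeal] at hv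
  let _ : Field (A ⧸ (v.under A).asIdeal) := Ideal.Quotient.field _
  have hz : Ideal.Quotient.mk v.asIdeal z ∈
      (⊥ : Subalgebra (A ⧸ (v.under A).asIdeal) (B ⧸ v.asIdeal)) :=
    Subalgebra.bot_eq_top_of_finrank_eq_one hv ▸ Algebra.mem_top
  obtain ⟨a, ha⟩ := Algebra.mem_bot.mp hz
  obtain ⟨a, rfl⟩ := Ideal.Quotient.mk_surjective a
  exact ⟨a, Ideal.Quotient.eq.mp ha⟩

end Residues

section SIntegers

variable {R K : Type*} [CommRing R] [IsDedekindDomain R] [Field K] [Algebra R K]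
  [IsFractionRing R K] (S : Set (HeightOneSpectrum R)) (q : HeightOneSpectrum R)

variable (K) in
/-- The prime ideal of the ring of `S`-integers defined by a prime `q ∉ S`. -/
noncomputable def sIntegerPrime (hq : q ∉ S) : Ideal (S.integer K) :=
  ((q.valuation K).ltIdeal 1).comap
    ((S.integer K).val.toRingHom.codRestrict (q.valuation K).integer fun r => r.2 q hq)

variable {S q}

theorem mem_sIntegerPrime {hq : q ∉ S} {r : S.integer K} :
    r ∈ sIntegerPrime K S q hq ↔ q.valuation K (r : K) < 1 :=
  Iff.rfl

theorem comap_algebraMap_sIntegerPrime (hq : q ∉ S) :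
    (sIntegerPrime K S q hq).comap (algebraMap R (S.integer K)) = q.asIdeal := by
  ext a
  rw [Ideal.mem_comap, mem_sIntegerPrime]
  exact q.valuation_lt_one_iff_mem a

theorem eq_of_sIntegerPrime_eq {q' : HeightOneSpectrum R} {hq : q ∉ S} {hq' : q' ∉ S}
    (h : sIntegerPrime K S q hq = sIntegerPrime K S q' hq') : q = q' :=
  HeightOneSpectrum.ext <| by
    rw [← comap_algebraMap_sIntegerPrime (K := K) hq, h, comap_algebraMap_sIntegerPrime]

variable (K) in
/-- The residue field of the ring of `S`-integers at `q ∉ S` is that of the Dedekind ring. -/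
noncomputable def quotientSIntegerPrimeEquiv (hq : q ∉ S) :
    (R ⧸ q.asIdeal) ≃+* (S.integer K ⧸ sIntegerPrime K S q hq) :=
  RingEquiv.ofBijective (Ideal.quotientMap (sIntegerPrime K S q hq)
    (algebraMap R (S.integer K)) (comap_algebraMap_sIntegerPrime hq).ge) <| by
    refine ⟨Ideal.quotientMap_injective' (comap_algebraMap_sIntegerPrime hq).le, fun r => ?_⟩
    obtain ⟨r, rfl⟩ := Ideal.Quotient.mk_surjective r
    obtain ⟨a, ha⟩ := q.exists_valuation_sub_lt_of_integer (r.2 q hq) 1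
    exact ⟨Ideal.Quotient.mk _ a, Ideal.quotientMap_mk.trans (Ideal.Quotient.eq.mpr ha)⟩

theorem isMaximal_sIntegerPrime (hq : q ∉ S) : (sIntegerPrime K S q hq).IsMaximal :=
  have := q.isMaximal
  Ideal.Quotient.maximal_of_isField _
    ((quotientSIntegerPrimeEquiv K hq).symm.toMulEquiv.isField
      (Ideal.Quotient.field q.asIdeal).toIsField)

theorem card_quotient_sIntegerPrime (hq : q ∉ S) :
    Nat.card (S.integer K ⧸ sIntegerPrime K S q hq) = Nat.card (R ⧸ q.asIdeal) :=
  (Nat.card_congr (quotientSIntegerPrimeEquiv K hq).toEquiv).symm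

end SIntegers

section SUnits

variable {R K : Type*} [CommRing R] [IsDedekindDomain R] [Field K] [Algebra R K]
  [IsFractionRing R K] {S : Set (HeightOneSpectrum R)}

variable (K S) in
/-- The valuations of an `S`-unit at the primes in `S`. -/
noncomputable def sUnitValuation : (S.integer K)ˣ →* (S → Multiplicative ℤ) :=
  MonoidHom.pi fun v => v.1.valuationOfNeZero.comp (Units.map (S.integer K).val.toMonoidHom)

theorem valuation_eq_one_of_mem_ker_sUnitValuation {u : (S.integer K)ˣ}
    (hu : u ∈ (sUnitValuation K S).ker) (v : HeightOneSpectrum R) :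
    v.valuation K (u : S.integer K) = 1 := by
  by_cases hv : v ∈ S
  · exact (v.valuationOfNeZero_eq (Units.map (S.integer K).val.toMonoidHom u)).symm.trans
      (congrArg _ (congrFun hu ⟨v, hv⟩))
  · exact Set.unit_valuation_eq_one S K ((S.unitEquivUnitsInteger K).symm u) hv

theorem range_map_algebraMap_eq_ker_sUnitValuation :
    (Units.map (algebraMap R (S.integer K)).toMonoidHom).range = (sUnitValuation K S).ker := by
  ext u
  constructor
  · rintro ⟨x, rfl⟩
    exact funext fun v => v.1.valuation_of_unit_eq x
  · intro hu
    obtain ⟨a, ha⟩ := HeightOneSpectrum.mem_integers_of_valuation_le_one K _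
      fun v => (valuation_eq_one_of_mem_ker_sUnitValuation hu v).le
    obtain ⟨b, hb⟩ := HeightOneSpectrum.mem_integers_of_valuation_le_one K _
      fun v => (valuation_eq_one_of_mem_ker_sUnitValuation (inv_mem hu) v).le
    have hab : a * b = 1 := IsFractionRing.injective R K <| by
      rw [map_mul, ha, hb, map_one, ← MulMemClass.coe_mul, Units.mul_inv, OneMemClass.coe_one]
    exact ⟨Units.mkOfMulEqOne a b hab, Units.ext (Subtype.ext ha)⟩

theorem fg_units_integer [Group.FG Rˣ] (hS : S.Finite) : Group.FG (S.integer K)ˣ := by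
  have := hS.to_subtype
  let φ : Additive Rˣ →ₗ[ℤ] Additive (S.integer K)ˣ :=
    (Units.map (algebraMap R (S.integer K)).toMonoidHom).toAdditive.toIntLinearMap
  let ψ : Additive (S.integer K)ˣ →ₗ[ℤ] (S → ℤ) :=
    AddMonoidHom.toIntLinearMap (MonoidHom.toAdditiveLeft (sUnitValuation K S))
  have hexact : LinearMap.range φ = LinearMap.ker ψ := by
    ext u
    exact SetLike.ext_iff.mp (range_map_algebraMap_eq_ker_sUnitValuation (K := K) (S := S)) u.toMul
  have := Module.Finite.iff_addGroup_fg.mpr (GroupFG.iff_add_fg.mp ‹Group.FG Rˣ›)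
  have := isNoetherian_of_range_eq_ker φ ψ hexact
  exact GroupFG.iff_add_fg.mpr (Module.Finite.iff_addGroup_fg.mp inferInstance)

theorem finite_quotient_square_of_fg (G : Type*) [CommGroup G] [Group.FG G] :
    Finite (G ⧸ Subgroup.square G) := by
  refine CommGroup.finite_of_fg_isMulTorsion _ fun x => ?_
  obtain ⟨u, rfl⟩ := QuotientGroup.mk_surjective x
  refine isOfFinOrder_iff_pow_eq_one.mpr ⟨2, two_pos, ?_⟩
  rw [← QuotientGroup.mk_pow, QuotientGroup.eq_one_iff]
  exact ⟨u, sq u⟩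

theorem finite_units_integer_quotient_square {K : Type*} [Field K] [NumberField K]
    {S : Set (HeightOneSpectrum (𝓞 K))} (hS : S.Finite) :
    Finite ((S.integer K)ˣ ⧸ Subgroup.square (S.integer K)ˣ) :=
  have : Group.FG (𝓞 K)ˣ := Group.fg_iff_monoid_fg.mpr inferInstance
  have := fg_units_integer (K := K) hS
  finite_quotient_square_of_fg _

end SUnits

section Genus

variable {R : Type*} [CommRing R]

namespace BinForm

theorem disc_map {R' : Type*} [CommRing R'] (φ : R →+* R') (q : BinForm R) :
    (q.map φ).disc = φ q.disc := by
  simp only [disc, map, map_sub, map_mul, map_pow, map_ofNat]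

theorem eval_map {R' : Type*} [CommRing R'] (φ : R →+* R') (q : BinForm R) (x y : R) :
    (q.map φ).eval (φ x) (φ y) = φ (q.eval x y) := by
  simp only [eval, map, map_add, map_mul, map_pow]

theorem four_mul_a_mul_eval (q : BinForm R) (x y : R) :
    4 * q.a * q.eval x y = (2 * q.a * x + q.b * y) ^ 2 - q.disc * y ^ 2 := by
  simp only [disc, eval]
  ring

theorem Equivalent.exists_eval_eq {q q' : BinForm R} (h : q.Equivalent q') :
    ∃ e : Rˣ, ∀ x y, ∃ x' y', q'.eval x y = e * q.eval x' y' := by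
  obtain ⟨M, rfl⟩ := h
  exact ⟨_, fun x y => ⟨_, _, eval_twistedAct M q x y⟩⟩

theorem Equivalent.exists_unit_mul_eval_eq {q q' : BinForm R} (h : q.Equivalent q') :
    ∃ e : Rˣ, ∀ x y, ∃ x' y', e * q.eval x y = q'.eval x' y' := by
  obtain ⟨M, rfl⟩ := h
  refine ⟨(Matrix.GeneralLinearGroup.det M)⁻¹, fun x y => ?_⟩
  let v : Fin 2 → R := (M⁻¹).val.mulVec ![x, y]
  have hv : M.val.mulVec v = ![x, y] := by
    rw [Matrix.mulVec_mulVec, Units.mul_inv, Matrix.one_mulVec]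
  have hx : M 0 0 * v 0 + M 0 1 * v 1 = x := by
    simpa [Matrix.mulVec, dotProduct] using congrFun hv 0
  have hy : M 1 0 * v 0 + M 1 1 * v 1 = y := by
    simpa [Matrix.mulVec, dotProduct] using congrFun hv 1
  exact ⟨v 0, v 1, by rw [eval_twistedAct, hx, hy]⟩

theorem exists_equivalent_eval_eq (q : BinForm R) (e : Rˣ) :
    ∃ q', q.Equivalent q' ∧ ∀ x y, ∃ x' y', q'.eval x' y' = e * q.eval x y := by
  let M : GL (Fin 2) R := Matrix.GeneralLinearGroup.mk'' !![1, 0; 0, ((e⁻¹ : Rˣ) : R)] <| by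
    simp [Matrix.det_fin_two]
  have hdet : (Matrix.GeneralLinearGroup.det M)⁻¹ = e :=
    inv_eq_iff_eq_inv.mpr <| Units.ext <| by simp [M, Matrix.det_fin_two]
  refine ⟨twistedAct M q, ⟨M, rfl⟩, fun x y => ⟨x, e * y, ?_⟩⟩
  rw [eval_twistedAct, hdet]
  congr 2 <;> simp [M]

theorem mem_classVals_iff (Δ : R) (q : BinForm R) (w : (R ⧸ Ideal.span {Δ})ˣ) :
    w ∈ classVals Δ q ↔ ∃ (e : Rˣ) (x y : R ⧸ Ideal.span {Δ}),
      (w : R ⧸ Ideal.span {Δ}) = Ideal.Quotient.mk _ (e : R) *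
        (q.map (Ideal.Quotient.mk _)).eval x y := by
  have hmk := Ideal.Quotient.mk_surjective (I := Ideal.span {Δ})
  simp only [classVals, vals, Set.mem_iUnion, exists_prop, Set.mem_ofPred_eq]
  constructor
  · rintro ⟨q', hq', x, y, hw⟩
    obtain ⟨e, he⟩ := hq'.exists_eval_eq
    obtain ⟨x, rfl⟩ := hmk x
    obtain ⟨y, rfl⟩ := hmk y
    obtain ⟨x', y', h⟩ := he x y
    exact ⟨e, Ideal.Quotient.mk _ x', Ideal.Quotient.mk _ y', by
      rw [hw, eval_map, eval_map, h, map_mul]⟩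
  · rintro ⟨e, x, y, hw⟩
    obtain ⟨q', hq', he⟩ := q.exists_equivalent_eval_eq e
    obtain ⟨x, rfl⟩ := hmk x
    obtain ⟨y, rfl⟩ := hmk y
    obtain ⟨x', y', h⟩ := he x y
    exact ⟨q', hq', Ideal.Quotient.mk _ x', Ideal.Quotient.mk _ y', by
      rw [hw, eval_map, eval_map, h, map_mul]⟩

/-- Modulo `f` the form is `a⁻¹` times a square, and `a⁻¹` is itself a unit times a square. -/
theorem mem_classVals_iff_exists_sq {f h : R} {q : BinForm R} (e : Rˣ) (h2 : IsUnit (2 : R))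
    (hdisc : q.disc = 4 * f) (hcop : IsCoprime q.a f) (hsq : f ∣ h ^ 2 - e * q.a)
    (w : (R ⧸ Ideal.span {4 * f})ˣ) :
    w ∈ classVals (4 * f) q ↔ ∃ (e' : Rˣ) (x : R ⧸ Ideal.span {4 * f}),
      (w : R ⧸ Ideal.span {4 * f}) = Ideal.Quotient.mk _ (e' : R) * x ^ 2 := by
  rw [mem_classVals_iff]
  let π := Ideal.Quotient.mk (Ideal.span {4 * f})
  have hπ {r : R} (hr : f ∣ r) : π r = 0 := by
    have h4 : IsUnit (4 : R) := (show (4 : R) = 2 ^ 2 by norm_num) ▸ h2.pow 2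
    exact (Ideal.Quotient.eq_zero_iff_dvd _ _).mpr (h4.mul_left_dvd.mpr hr)
  have hπdisc : (q.map π).disc = 0 := by
    rw [disc_map, hdisc]
    exact hπ (dvd_mul_left _ _)
  have hea : π h ^ 2 = π e * π q.a := by
    rw [← map_pow, ← map_mul, ← sub_eq_zero, ← map_sub]
    exact hπ hsq
  have hunit : IsUnit (π h) := by
    obtain ⟨r, s, hrs⟩ := hcop
    have ha : π r * π q.a = 1 := by
      rw [← map_mul, ← map_one π, ← hrs, map_add, hπ (dvd_mul_left f s), add_zero]
    refine (isUnit_pow_iff two_ne_zero).mp ?_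
    rw [hea]
    exact (e.isUnit.map π).mul (.of_mul_eq_one_right _ ha)
  obtain ⟨k, hk⟩ := ((h2.map π).mul hunit).exists_right_inv
  rw [map_ofNat] at hk
  have hk' : 4 * (π e * π q.a) * k ^ 2 = 1 := by
    linear_combination (-4 * k ^ 2) * hea + (2 * π h * k + 1) * hk
  constructor
  · rintro ⟨e', x, y, hw⟩
    refine ⟨e' * e, (2 * π q.a * x + π q.b * y) * k, hw.trans ?_⟩
    have hval := (q.map π).four_mul_a_mul_eval x y
    rw [hπdisc, zero_mul, sub_zero] at hval
    rw [Units.val_mul, map_mul]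
    change 4 * π q.a * _ = (2 * π q.a * x + π q.b * y) ^ 2 at hval
    linear_combination (-π e' * (q.map π).eval x y) * hk' + (π e' * π e * k ^ 2) * hval
  · rintro ⟨e', x, hw⟩
    refine ⟨e' * e, 2 * k * x, 0, hw.trans ?_⟩
    rw [Units.val_mul, map_mul, show (q.map π).eval (2 * k * x) 0 = π q.a * (2 * k * x) ^ 2 by
      simp only [eval, map]; ring]
    linear_combination (-π e' * x ^ 2) * hk'

theorem inPrincipalGenus_of_dvd {f h : R} {q : BinForm R} (e : Rˣ) (h2 : IsUnit (2 : R))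
    (hdisc : q.disc = 4 * f) (hcop : IsCoprime q.a f) (hsq : f ∣ h ^ 2 - e * q.a) :
    InPrincipalGenus f q := by
  ext w
  rw [mem_classVals_iff_exists_sq e h2 hdisc hcop hsq, mem_classVals_iff_exists_sq (h := 1) 1 h2
    (disc_principal f) isCoprime_one_left (by simp [principal])]

end BinForm

theorem exists_mul_dvd_sq_sub_of_isCoprime {p g a x y : R} (hpg : IsCoprime p g)
    (hx : p ∣ x ^ 2 - a) (hy : g ∣ y ^ 2 - a) : ∃ z, p * g ∣ z ^ 2 - a := by
  obtain ⟨r, s, hrs⟩ := id hpg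
  have hzx : y * (r * p) + x * (s * g) - x = p * (r * (y - x)) := by linear_combination x * hrs
  have hzy : y * (r * p) + x * (s * g) - y = g * (s * (x - y)) := by linear_combination y * hrs
  refine ⟨y * (r * p) + x * (s * g), hpg.mul_dvd ?_ ?_⟩
  · rw [← sub_add_sub_cancel _ (x ^ 2)]
    exact dvd_add ((Dvd.intro _ hzx.symm).trans (sub_dvd_pow_sub_pow _ _ 2)) hx
  · rw [← sub_add_sub_cancel _ (y ^ 2)]
    exact dvd_add ((Dvd.intro _ hzy.symm).trans (sub_dvd_pow_sub_pow _ _ 2)) hy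

theorem exists_dvd_sq_sub_of_sq_eq_aeval_gen {K L : Type*} [Field K] [Field L] [Algebra K L]
    {a p : K[X]} (hp : Irreducible p) {ρ : L} (hρ : aeval ρ p = 0) {y : K⟮ρ⟯}
    (hy : y ^ 2 = aeval (AdjoinSimple.gen K ρ) a) : ∃ z : K[X], p ∣ z ^ 2 - a := by
  have hint : IsIntegral K ρ := isAlgebraic_iff_isIntegral.mp ⟨p, hp.ne_zero, hρ⟩
  obtain ⟨z, hz⟩ : ∃ z : K[X], aeval ρ z = (y : L) := by
    have hmem : (y : L) ∈ K⟮ρ⟯.toSubalgebra := y.2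
    rwa [adjoin_simple_toSubalgebra_of_isAlgebraic hint.isAlgebraic,
      Algebra.adjoin_singleton_eq_range_aeval] at hmem
  have hroot : aeval ρ (z ^ 2 - a) = 0 := by
    have hya := congrArg (algebraMap K⟮ρ⟯ L) hy
    rw [map_pow, ← aeval_algebraMap_apply, AdjoinSimple.algebraMap_gen] at hya
    rw [map_sub, map_pow, hz, sub_eq_zero]
    exact hya
  exact ⟨z, ((minpoly.irreducible hint).associated_of_dvd hp
    (minpoly.dvd K ρ hρ)).dvd_iff_dvd_left.mp (minpoly.dvd K ρ hroot)⟩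

theorem exists_dvd_sq_sub_of_forall_root {K Ω : Type*} [Field K] [Field Ω] [IsAlgClosed Ω]
    [Algebra K Ω] (a : K[X]) {g : K[X]} (hg : Squarefree g)
    (h : ∀ ρ : Ω, aeval ρ g = 0 → ∃ y : K⟮ρ⟯, y ^ 2 = aeval (AdjoinSimple.gen K ρ) a) :
    ∃ z : K[X], g ∣ z ^ 2 - a := by
  induction g using WfDvdMonoid.induction_on_irreducible with
  | zero => exact (not_squarefree_zero hg).elim
  | unit u hu => exact ⟨0, hu.dvd⟩
  | mul g p _ hp ih =>
    obtain ⟨y, hy⟩ := ih hg.of_mul_right fun ρ hρ => h ρ (by rw [map_mul, hρ, mul_zero])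
    obtain ⟨ρ, hρ⟩ := IsAlgClosed.exists_aeval_eq_zero Ω p (degree_pos_of_irreducible hp).ne'
    obtain ⟨s, hs⟩ := h ρ (by rw [map_mul, hρ, zero_mul])
    obtain ⟨x, hx⟩ := exists_dvd_sq_sub_of_sq_eq_aeval_gen hp hρ hs
    have hcop : IsCoprime p g := hp.coprime_iff_not_dvd.mpr fun hdvd =>
      hp.not_isUnit (hg p (mul_dvd_mul_left p hdvd))
    exact exists_mul_dvd_sq_sub_of_isCoprime hcop hx hy

theorem squarefree_map_of_monic [IsDomain R] [IsIntegrallyClosed R] (K : Type*) [Field K]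
    [Algebra R K] [IsFractionRing R K] {f : R[X]} (hf : f.Monic) (hsq : Squarefree f) :
    Squarefree (f.map (algebraMap R K)) := by
  intro g hg
  have hgdvd : g ∣ f.map (algebraMap R K) := dvd_of_mul_right_dvd hg
  obtain ⟨g', hg'⟩ := IsIntegrallyClosed.eq_map_mul_C_of_dvd K hf hgdvd
  have hlead : g.leadingCoeff ≠ 0 :=
    leadingCoeff_ne_zero.mpr (ne_zero_of_dvd_ne_zero (hf.map (algebraMap R K)).ne_zero hgdvd)
  have hmonic : g'.Monic := by
    refine monic_of_injective (IsFractionRing.injective R K) ?_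
    have := congrArg leadingCoeff hg'
    rw [leadingCoeff_mul, leadingCoeff_C] at this
    exact (mul_eq_right₀ hlead).mp this
  have hdvd : (g' * g').map (algebraMap R K) ∣ f.map (algebraMap R K) := by
    have hg'dvd : g'.map (algebraMap R K) ∣ g := Dvd.intro _ hg'
    rw [Polynomial.map_mul]
    exact (mul_dvd_mul hg'dvd hg'dvd).trans hg
  rw [map_dvd_map _ (IsFractionRing.injective R K) (hmonic.mul hmonic)] at hdvd
  rw [← hg']
  exact ((hsq g' hdvd).map (mapRingHom (algebraMap R K))).mul (isUnit_C.mpr hlead.isUnit)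

end Genus

section SqrtExt

variable {F Ω : Type*} [Field F] [Field Ω] [Algebra F Ω]

theorem sqrtExt_eq_adjoin_simple (d : F) {s : Ω} (hs : s ^ 2 = algebraMap F Ω d) :
    sqrtExt (Ω := Ω) d = F⟮s⟯ := by
  refine le_antisymm (adjoin_le_iff.mpr fun t ht => ?_)
    (adjoin_simple_le_iff.mpr (subset_adjoin F _ hs))
  rcases sq_eq_sq_iff_eq_or_eq_neg.mp (ht.trans hs.symm) with rfl | rfl
  · exact mem_adjoin_simple_self F t
  · exact neg_mem (mem_adjoin_simple_self F s)

theorem finrank_sqrtExt {d : F} (hd : ¬ ∃ y : F, y ^ 2 = d) {s : Ω}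
    (hs : s ^ 2 = algebraMap F Ω d) : Module.finrank F (sqrtExt (Ω := Ω) d) = 2 := by
  have hirr : Irreducible (X ^ 2 - C d : F[X]) :=
    X_pow_sub_C_irreducible_of_prime Nat.prime_two fun b hb => hd ⟨b, hb⟩
  have hmonic : (X ^ 2 - C d : F[X]).Monic := monic_X_pow_sub_C d two_ne_zero
  have hroot : aeval s (X ^ 2 - C d : F[X]) = 0 := by simp [hs]
  rw [sqrtExt_eq_adjoin_simple d hs, adjoin.finrank ⟨_, hmonic, hroot⟩,
    ← minpoly.eq_of_irreducible_of_monic hirr hroot hmonic, natDegree_X_pow_sub_C]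

end SqrtExt

section Specialization

theorem exists_unit_mul_eval_eq_of_mem_trivialSpecializations {K : Type*} [Field K] [NumberField K]
    {S : Set (HeightOneSpectrum (𝓞 K))} {f : (𝓞 K)[X]} {q : BinForm (S.integer K)[X]}
    {n : S.integer K} (hn : n ∈ trivialSpecializations f q) :
    ∃ (u : (S.integer K)ˣ) (x y : S.integer K),
      (u : S.integer K) * q.a.eval n = x ^ 2 - aeval n f * y ^ 2 := by
  obtain ⟨u, hu⟩ := BinForm.Equivalent.exists_unit_mul_eval_eq hn
  obtain ⟨x, y, hxy⟩ := hu 1 0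
  refine ⟨u, x, y, ?_⟩
  simpa [BinForm.eval, BinForm.map, BinForm.principal, sub_eq_add_neg] using hxy

variable {R F Γ₀ : Type*} [CommRing R] [Field F] [LinearOrderedCommGroupWithZero Γ₀]
  {w : Valuation F Γ₀} {φ : R →+* F} {t : F}

theorem valuation_eval₂_le_one (hφ : ∀ r, w (φ r) ≤ 1) (ht : w t ≤ 1) (p : R[X]) :
    w (eval₂ φ t p) ≤ 1 := by
  rw [eval₂_eq_sum_range]
  refine w.map_sum_le fun i _ => ?_
  rw [map_mul, map_pow]
  exact mul_le_one' (hφ _) (pow_le_one' ht i)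

theorem valuation_map_eval_sub_eval₂_lt_one (hφ : ∀ r, w (φ r) ≤ 1) (ht : w t ≤ 1) {n : R}
    (hn : w (φ n - t) < 1) (p : R[X]) : w (φ (p.eval n) - eval₂ φ t p) < 1 := by
  let ψ : R →+* w.integer := φ.codRestrict w.integer hφ
  have hdvd := sub_dvd_eval_sub (ψ n) ⟨t, ht⟩ (p.map ψ)
  have hmem : (p.map ψ).eval (ψ n) - (p.map ψ).eval ⟨t, ht⟩ ∈ w.ltIdeal 1 :=
    Ideal.mem_of_dvd _ hdvd hn
  rw [eval_map, eval_map, eval₂_at_apply, Valuation.mem_ltIdeal_iff] at hmem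
  have hval : ((eval₂ ψ ⟨t, ht⟩ p : w.integer) : F) = eval₂ φ t p :=
    hom_eval₂ p ψ w.integer.subtype ⟨t, ht⟩
  rw [← hval]
  exact hmem

theorem valuation_sq_sub_mul_eval₂_lt_one (hφ : ∀ r, w (φ r) ≤ 1) (ht : w t ≤ 1) {n : R}
    (hn : w (φ n - t) < 1) {A f : R[X]} (hf : eval₂ φ t f = 0) {u x y : R}
    (hxy : u * A.eval n = x ^ 2 - f.eval n * y ^ 2) : w (φ x ^ 2 - φ u * eval₂ φ t A) < 1 := by
  have h := valuation_map_eval_sub_eval₂_lt_one hφ ht hn (C u * A + f * C (y ^ 2))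
  have hx : (C u * A + f * C (y ^ 2)).eval n = x ^ 2 := by
    simp only [eval_add, eval_mul, eval_C]
    linear_combination hxy
  rwa [hx, eval₂_add, eval₂_mul, eval₂_mul, eval₂_C, hf, zero_mul, add_zero, map_pow] at h

end Specialization

section DensityZero

variable {K : Type*} [Field K] [NumberField K] {S : Set (HeightOneSpectrum (𝓞 K))}

instance infinite_integer : Infinite (S.integer K) :=
  .of_injective (algebraMap (𝓞 K) (S.integer K))
    (.of_comp (f := algebraMap (S.integer K) K) RingOfIntegers.coe_injective)

section NumberField

variable {F : Type*} [Field F] [NumberField F]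

theorem finite_valuation_ne_one {d : F} (hd : d ≠ 0) :
    {v : HeightOneSpectrum (𝓞 F) | v.valuation F d ≠ 1}.Finite := by
  refine ((HeightOneSpectrum.Support.finite (𝓞 F) d).union
    (HeightOneSpectrum.Support.finite (𝓞 F) d⁻¹)).subset fun v hv => ?_
  refine (lt_or_gt_of_ne hv).symm.imp_right fun h => ?_
  change 1 < v.valuation F d⁻¹
  rw [map_inv₀]
  exact (one_lt_inv₀ (zero_lt_iff.mpr ((v.valuation F).ne_zero_iff.mpr hd))).mpr h

variable [Algebra K F]

theorem finite_primesOver (hS : S.Finite) : (primesOver S F).Finite := by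
  have hunion : primesOver S F = ⋃ q ∈ S, {v | v.asIdeal.LiesOver q.asIdeal} := by
    ext v
    simp [primesOver]
  rw [hunion]
  refine hS.biUnion fun q _ => ?_
  have := q.isMaximal
  exact Set.Finite.of_injOn (t := q.asIdeal.primesOver (𝓞 F)) (fun v hv => ⟨v.isPrime, hv⟩)
    (fun v _ w _ h => HeightOneSpectrum.ext h)
    (IsDedekindDomain.primesOver_finite q.asIdeal (𝓞 F))

theorem under_notMem_of_notMem_primesOver {v : HeightOneSpectrum (𝓞 F)}
    (hv : v ∉ primesOver S F) : v.under (𝓞 K) ∉ S :=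
  fun h => hv ⟨_, h, inferInstance⟩

theorem valuation_algebraMap_integer_le_one {v : HeightOneSpectrum (𝓞 F)}
    (hv : v ∉ primesOver S F) (r : S.integer K) : v.valuation F (algebraMap K F r) ≤ 1 := by
  rw [← HeightOneSpectrum.valuation_liesOver F (v.under (𝓞 K)) v]
  exact pow_le_one' (r.2 _ (under_notMem_of_notMem_primesOver hv)) _

theorem IsDensity.le_prod_one_sub_absNorm {δ : Set (S.integer K) → ℝ} (hδ : IsDensity δ)
    {ι : Type*} [Fintype ι] {v : ι → HeightOneSpectrum (𝓞 F)}
    (hdeg : ∀ i, (v i).asIdeal.inertiaDeg (𝓞 K) = 1) (hS : ∀ i, v i ∉ primesOver S F)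
    (hinj : Function.Injective fun i => (v i).under (𝓞 K)) (z : 𝓞 F) {X : Set (S.integer K)}
    (hX : ∀ n ∈ X, ∀ i, 1 ≤ (v i).valuation F (algebraMap K F n - z)) :
    δ X ≤ ∏ i, (1 - 1 / (Ideal.absNorm (v i).asIdeal : ℝ)) := by
  let q (i : ι) : HeightOneSpectrum (𝓞 K) := (v i).under (𝓞 K)
  have hq (i : ι) : q i ∉ S := under_notMem_of_notMem_primesOver (hS i)
  have (i : ι) : (sIntegerPrime K S (q i) (hq i)).IsMaximal := isMaximal_sIntegerPrime (hq i)
  have (i : ι) : Finite (S.integer K ⧸ sIntegerPrime K S (q i) (hq i)) :=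
    have := Ideal.finiteQuotientOfFreeOfNeBot (q i).asIdeal (q i).ne_bot
    .of_equiv _ (quotientSIntegerPrimeEquiv K (hq i)).toEquiv
  choose a ha using fun i => exists_sub_mem_of_inertiaDeg_eq_one (hdeg i) z
  refine (hδ.le_prod_one_sub (P := fun i => sIntegerPrime K S (q i) (hq i))
    (fun i j hij => hinj (eq_of_sIntegerPrime_eq hij))
    (fun i => algebraMap (𝓞 K) (S.integer K) (a i)) fun n hn i hmem => ?_).trans_eq ?_
  · have hna : (v i).valuation F (algebraMap K F n - algebraMap K F (a i)) < 1 := by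
      rw [← map_sub]
      exact (valuation_lt_one_iff_valuation_algebraMap_lt_one (q i) (v i)).mpr hmem
    have haz : (v i).valuation F (algebraMap K F (a i) - z) < 1 :=
      ((v i).valuation_lt_one_iff_mem _).mpr (ha i)
    refine (hX n hn i).not_gt ?_
    rw [← sub_add_sub_cancel _ (algebraMap K F (a i))]
    exact Valuation.map_add_lt _ hna haz
  · refine Finset.prod_congr rfl fun i _ => ?_
    rw [card_quotient_sIntegerPrime, ← absNorm_under_eq_of_inertiaDeg_eq_one (hdeg i)]
    rfl

theorem IsDensity.eq_zero_of_not_summable {δ : Set (S.integer K) → ℝ} (hδ : IsDensity δ)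
    {G : Set (HeightOneSpectrum (𝓞 F))} (hdeg : ∀ v ∈ G, v.asIdeal.inertiaDeg (𝓞 K) = 1)
    (hS : ∀ v ∈ G, v ∉ primesOver S F)
    (hsum : ¬ Summable fun v : G => 1 / (Ideal.absNorm v.1.asIdeal : ℝ)) (z : 𝓞 F)
    {X : Set (S.integer K)} (hX : ∀ n ∈ X, ∀ v ∈ G, 1 ≤ v.valuation F (algebraMap K F n - z)) :
    δ X = 0 := by
  refine le_antisymm (le_of_forall_pos_lt_add fun ε hε => ?_) (hδ.mem_Icc X).1
  obtain ⟨T, hinj, hT⟩ := exists_finset_injOn_under_prod_lt K hdeg hsum hε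
  rw [zero_add]
  refine lt_of_le_of_lt ?_ hT
  rw [← Finset.prod_coe_sort]
  exact hδ.le_prod_one_sub_absNorm (v := fun v : T => v.1.1) (fun v => hdeg _ v.1.2)
    (fun v => hS _ v.1.2) hinj.injective z fun n hn v => hX n hn _ v.1.2

theorem not_summable_one_div_absNorm_inert_diff (hS : S.Finite) {F' : Type*} [Field F']
    [NumberField F'] [Algebra F F'] (hdeg : Module.finrank F F' = 2)
    {E : Set (HeightOneSpectrum (𝓞 F))} (hE : E.Finite) :
    ¬ Summable fun v : ({v | v ∉ primesOver S F ∧ v.asIdeal.inertiaDeg (𝓞 K) = 1 ∧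
      (v.asIdeal.map (algebraMap (𝓞 F) (𝓞 F'))).IsPrime} \ E : Set (HeightOneSpectrum (𝓞 F))) =>
        1 / (Ideal.absNorm v.1.asIdeal : ℝ) := by
  have hpos (v : HeightOneSpectrum (𝓞 F)) : 0 ≤ 1 / (Ideal.absNorm v.asIdeal : ℝ) := by
    positivity
  have hexc := (finite_primesOver (F := F) hS).union hE
  have hinert := not_summable_one_div_absNorm_inert (F := F) (F' := F') K hdeg
  refine not_summable_subtype_of_finite hpos hexc (fun v hv => ?_) hinert
  by_cases hexcv : v ∈ primesOver S F ∪ E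
  · exact Or.inr hexcv
  · exact Or.inl ⟨⟨fun h => hexcv (Or.inl h), hv⟩, fun h => hexcv (Or.inr h)⟩

end NumberField

section Root

variable {f : (𝓞 K)[X]} {A : (S.integer K)[X]} {u : (S.integer K)ˣ} {ρ : AlgebraicClosure K}

omit [NumberField K] in
theorem aeval_gen_eq_zero (hρ : aeval ρ f = 0) : aeval (AdjoinSimple.gen K ρ) f = 0 := by
  refine (algebraMap K⟮ρ⟯ (AlgebraicClosure K)).injective ?_
  rw [aeval_def] at hρ ⊢
  rwa [hom_eval₂, AdjoinSimple.algebraMap_gen, map_zero]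

omit [NumberField K] in
theorem isIntegral_gen (hmonic : f.Monic) (hρ : aeval ρ f = 0) :
    IsIntegral ℤ (AdjoinSimple.gen K ρ) :=
  have : IsScalarTower ℤ (𝓞 K) K⟮ρ⟯ := .of_algebraMap_eq' (RingHom.ext_int _ _)
  isIntegral_trans (A := 𝓞 K) _ ⟨f, hmonic, aeval_gen_eq_zero hρ⟩

theorem valuation_gen_le_one (hmonic : f.Monic) (hρ : aeval ρ f = 0)
    (v : HeightOneSpectrum (𝓞 K⟮ρ⟯)) : v.valuation K⟮ρ⟯ (AdjoinSimple.gen K ρ) ≤ 1 :=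
  v.valuation_le_one (⟨_, isIntegral_gen hmonic hρ⟩ : 𝓞 K⟮ρ⟯)

theorem valueAt_eq (A : (S.integer K)[X]) (u : (S.integer K)ˣ) (ρ : AlgebraicClosure K) :
    valueAt A u ρ = algebraMap (S.integer K) K⟮ρ⟯ u *
      eval₂ (algebraMap (S.integer K) K⟮ρ⟯) (AdjoinSimple.gen K ρ) A :=
  rfl

theorem valuation_valueAt_le_one (hmonic : f.Monic) (hρ : aeval ρ f = 0)
    {v : HeightOneSpectrum (𝓞 K⟮ρ⟯)} (hv : v ∉ primesOver S K⟮ρ⟯) :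
    v.valuation K⟮ρ⟯ (valueAt A u ρ) ≤ 1 := by
  rw [valueAt_eq, map_mul]
  exact mul_le_one' (valuation_algebraMap_integer_le_one hv _) <|
    valuation_eval₂_le_one (valuation_algebraMap_integer_le_one hv)
      (valuation_gen_le_one hmonic hρ v) A

theorem valuation_sq_sub_valueAt_lt_one (hmonic : f.Monic) (hρ : aeval ρ f = 0)
    {v : HeightOneSpectrum (𝓞 K⟮ρ⟯)} (hv : v ∉ primesOver S K⟮ρ⟯) {n x y : S.integer K}
    (hn : v.valuation K⟮ρ⟯ (algebraMap (S.integer K) K⟮ρ⟯ n - AdjoinSimple.gen K ρ) < 1)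
    (hxy : (u : S.integer K) * A.eval n = x ^ 2 - aeval n f * y ^ 2) :
    v.valuation K⟮ρ⟯ (algebraMap (S.integer K) K⟮ρ⟯ x ^ 2 - valueAt A u ρ) < 1 := by
  refine valuation_sq_sub_mul_eval₂_lt_one (f := f.map (algebraMap (𝓞 K) (S.integer K)))
    (valuation_algebraMap_integer_le_one hv) (valuation_gen_le_one hmonic hρ v) hn ?_
    (y := y) (by rwa [eval_map_algebraMap])
  rw [eval₂_map]
  exact aeval_gen_eq_zero hρ

namespace IsNonsquareRoot

theorem not_exists_sq (hmonic : f.Monic) (h : IsNonsquareRoot f A u ρ) :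
    ¬ ∃ y : K⟮ρ⟯, y ^ 2 = valueAt A u ρ := by
  rintro ⟨y, hy⟩
  refine h.2 ⟨y, fun v hv => (pow_le_one_iff two_ne_zero).mp ?_, hy⟩
  rw [← map_pow, hy]
  exact valuation_valueAt_le_one hmonic h.1 hv

theorem valueAt_ne_zero (h : IsNonsquareRoot f A u ρ) : valueAt A u ρ ≠ 0 :=
  fun h0 => h.2 ⟨0, zero_mem _, by rw [h0, zero_pow two_ne_zero]⟩

theorem isQuadraticExtension_sqrtExt (hmonic : f.Monic) (h : IsNonsquareRoot f A u ρ) :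
    Algebra.IsQuadraticExtension K⟮ρ⟯ (sqrtExt (Ω := AlgebraicClosure K) (valueAt A u ρ)) := by
  obtain ⟨s, hs⟩ := IsAlgClosed.exists_pow_nat_eq
    (algebraMap K⟮ρ⟯ (AlgebraicClosure K) (valueAt A u ρ)) two_pos
  exact ⟨finrank_sqrtExt (h.not_exists_sq hmonic) hs⟩

/-- If `n ≡ ρ` modulo a prime that is inert in `K(ρ, √(u A(ρ)))`, then `u A(ρ)` would be the square
`x²` modulo that prime. -/
theorem one_le_valuation_sub_gen (hmonic : f.Monic) (h : IsNonsquareRoot f A u ρ)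
    {v : HeightOneSpectrum (𝓞 K⟮ρ⟯)} (hv : v ∈ inertPrimes A u ρ) (h2 : v.valuation K⟮ρ⟯ 2 = 1)
    (hvd : v.valuation K⟮ρ⟯ (valueAt A u ρ) = 1) {n x y : S.integer K}
    (hxy : (u : S.integer K) * A.eval n = x ^ 2 - aeval n f * y ^ 2) :
    1 ≤ v.valuation K⟮ρ⟯ (algebraMap (S.integer K) K⟮ρ⟯ n - AdjoinSimple.gen K ρ) := by
  have := h.isQuadraticExtension_sqrtExt hmonic
  have : NumberField (sqrtExt (Ω := AlgebraicClosure K) (valueAt A u ρ)) :=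
    NumberField.of_module_finite K⟮ρ⟯ _
  obtain ⟨s, hs⟩ := IsAlgClosed.exists_pow_nat_eq
    (algebraMap K⟮ρ⟯ (AlgebraicClosure K) (valueAt A u ρ)) two_pos
  have hs' : (⟨s, subset_adjoin _ _ hs⟩ : sqrtExt (Ω := AlgebraicClosure K) (valueAt A u ρ)) ^ 2 =
      algebraMap _ _ (valueAt A u ρ) :=
    Subtype.ext hs
  by_contra! hn
  exact (one_le_valuation_sq_sub_of_isPrime_map hs' (h.not_exists_sq hmonic) hv.2.2 h2 hvd _).not_gt
    (valuation_sq_sub_valueAt_lt_one hmonic h.1 hv.1 hn hxy)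

theorem density_eq_zero (hmonic : f.Monic) (hS : S.Finite) {δ : Set (S.integer K) → ℝ}
    (hδ : IsDensity δ) (h : IsNonsquareRoot f A u ρ) :
    δ {n | ∃ x y : S.integer K, (u : S.integer K) * A.eval n = x ^ 2 - aeval n f * y ^ 2} = 0 := by
  have := h.isQuadraticExtension_sqrtExt hmonic
  have : NumberField (sqrtExt (Ω := AlgebraicClosure K) (valueAt A u ρ)) :=
    NumberField.of_module_finite K⟮ρ⟯ _
  have hsum := not_summable_one_div_absNorm_inert_diff hS
    (Algebra.IsQuadraticExtension.finrank_eq_two K⟮ρ⟯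
      (sqrtExt (Ω := AlgebraicClosure K) (valueAt A u ρ)))
    ((finite_valuation_ne_one two_ne_zero).union (finite_valuation_ne_one h.valueAt_ne_zero))
  refine hδ.eq_zero_of_not_summable (fun v hv => hv.1.2.1) (fun v hv => hv.1.1) hsum
    ⟨_, isIntegral_gen hmonic h.1⟩ ?_
  rintro n ⟨x, y, hxy⟩ v ⟨hv, hval⟩
  obtain ⟨h2, hvd⟩ := not_or.mp hval
  exact h.one_le_valuation_sub_gen hmonic hv (not_not.mp h2) (not_not.mp hvd) hxy

end IsNonsquareRoot

end Root

end DensityZero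

section Main

theorem multipliable_of_mem_Icc {ι : Type*} {g : ι → ℝ} (hg : ∀ i, g i ∈ Set.Icc 0 1) :
    Multipliable g := by
  classical
  refine ⟨⨅ s : Finset ι, ∏ i ∈ s, g i, tendsto_atTop_ciInf (fun s t hst => ?_) ⟨0, ?_⟩⟩
  · exact Finset.prod_le_prod_of_subset_of_le_one hst (fun i _ => (hg i).1) fun i _ _ => (hg i).2
  · rintro _ ⟨s, rfl⟩
    exact Finset.prod_nonneg fun i _ => (hg i).1

variable {K : Type*} [Field K] [NumberField K]

theorem one_sub_one_div_absNorm_mem_Icc (v : HeightOneSpectrum (𝓞 K)) :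
    1 - 1 / (Ideal.absNorm v.asIdeal : ℝ) ∈ Set.Icc 0 1 :=
  Set.Icc.one_sub_mem (one_div_absNorm_mem_Icc v)

variable {S : Set (HeightOneSpectrum (𝓞 K))} {f : (𝓞 K)[X]} {q : BinForm (S.integer K)[X]}

/-- If `u a(ρ)` were a square for every root `ρ` of `f`, then `u a` would be a square modulo `f` by
the Chinese remainder theorem. -/
theorem exists_isNonsquareRoot (hmonic : f.Monic) (hsq : Squarefree f)
    (hdisc : q.disc = 4 * f.map (algebraMap (𝓞 K) (S.integer K)))
    (hcop : IsCoprime (q.a.map (algebraMap (S.integer K) K)) (f.map (algebraMap (𝓞 K) K)))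
    (hgenus : ¬ BinForm.InPrincipalGenus (f.map (algebraMap (𝓞 K) K))
      (q.map (mapRingHom (algebraMap (S.integer K) K)))) (u : (S.integer K)ˣ) :
    ∃ ρ : AlgebraicClosure K, IsNonsquareRoot f q.a u ρ := by
  by_contra! hcon
  let ψ : S.integer K →+* K := algebraMap (S.integer K) K
  let e : K[X]ˣ := Units.map (C.comp ψ : S.integer K →+* K[X]) u
  have hroot (ρ : AlgebraicClosure K) (hρ : aeval ρ (f.map (algebraMap (𝓞 K) K)) = 0) :
      ∃ y : K⟮ρ⟯, y ^ 2 = aeval (AdjoinSimple.gen K ρ) ((e : K[X]) * q.a.map ψ) := by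
    rw [aeval_map_algebraMap] at hρ
    obtain ⟨y, -, hy⟩ := not_not.mp fun hy => hcon ρ ⟨hρ, hy⟩
    refine ⟨y, hy.trans ?_⟩
    rw [valueAt_eq, map_mul, aeval_map_algebraMap]
    congr 1
    exact (aeval_C (AdjoinSimple.gen K ρ) (ψ u)).symm
  obtain ⟨z, hz⟩ := exists_dvd_sq_sub_of_forall_root _ (squarefree_map_of_monic K hmonic hsq) hroot
  have h2 : IsUnit (2 : K[X]) := by
    rw [← map_ofNat C 2]
    exact isUnit_C.mpr two_ne_zero.isUnit
  refine hgenus (BinForm.inPrincipalGenus_of_dvd e h2 ?_ hcop hz)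
  rw [BinForm.disc_map, hdisc, map_mul, map_ofNat, coe_mapRingHom, Polynomial.map_map]
  rfl

theorem trivialSpecializations_subset_iUnion :
    trivialSpecializations f q ⊆ ⋃ ε : (S.integer K)ˣ ⧸ Subgroup.square (S.integer K)ˣ,
      {n | ∃ x y : S.integer K,
        (ε.out : S.integer K) * q.a.eval n = x ^ 2 - aeval n f * y ^ 2} := by
  intro n hn
  obtain ⟨u, x, y, hxy⟩ := exists_unit_mul_eval_eq_of_mem_trivialSpecializations hn
  let ε : (S.integer K)ˣ ⧸ Subgroup.square (S.integer K)ˣ := QuotientGroup.mk u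
  obtain ⟨t, ht⟩ : IsSquare (u⁻¹ * ε.out) :=
    Subgroup.mem_square.mp (QuotientGroup.eq.mp (QuotientGroup.out_eq' ε).symm)
  refine Set.mem_iUnion.mpr ⟨ε, t * x, t * y, ?_⟩
  have hε : (ε.out : S.integer K) = u * (t * t) :=
    congrArg Units.val (inv_mul_eq_iff_eq_mul.mp ht)
  rw [hε]
  linear_combination (t : S.integer K) ^ 2 * hxy

theorem density_trivialSpecializations_eq_zero (hmonic : f.Monic) (hS : S.Finite)
    {δ : Set (S.integer K) → ℝ} (hδ : IsDensity δ)
    (h : ∀ u : (S.integer K)ˣ, ∃ ρ : AlgebraicClosure K, IsNonsquareRoot f q.a u ρ) :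
    δ (trivialSpecializations f q) = 0 := by
  have := finite_units_integer_quotient_square (K := K) hS
  have := Fintype.ofFinite ((S.integer K)ˣ ⧸ Subgroup.square (S.integer K)ˣ)
  have hsub := trivialSpecializations_subset_iUnion (f := f) (q := q)
  rw [← Set.biUnion_univ, ← Finset.coe_univ] at hsub
  refine le_antisymm ?_ (hδ.mem_Icc _).1
  refine ((hδ.mono _ _ hsub).trans (hδ.biUnion_le _ _)).trans_eq ?_
  refine Finset.sum_eq_zero fun ε _ => ?_
  obtain ⟨ρ, hρ⟩ := h ε.out
  exact hρ.density_eq_zero hmonic hS hδ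

end Main

theorem mainTheorem6_general {K : Type*} [Field K] [NumberField K]
    {f : (𝓞 K)[X]} (hmonic : f.Monic) (hsq : Squarefree f)
    {S : Set (HeightOneSpectrum (𝓞 K))} (hS : S.Finite)
    {δ : Set (S.integer K) → ℝ} (hδ : IsDensity δ) {q : BinForm (S.integer K)[X]}
    (hdisc : q.disc = 4 * f.map (algebraMap (𝓞 K) (S.integer K)))
    (hcop : IsCoprime (q.a.map (algebraMap (S.integer K) K)) (f.map (algebraMap (𝓞 K) K)))
    (hgenus : ¬ BinForm.InPrincipalGenus (f.map (algebraMap (𝓞 K) K))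
      (q.map (mapRingHom (algebraMap (S.integer K) K)))) :
    Finite ((S.integer K)ˣ ⧸ Subgroup.square (S.integer K)ˣ) ∧
    (∀ u : (S.integer K)ˣ, ∃ ρ : AlgebraicClosure K, IsNonsquareRoot f q.a u ρ) ∧
    δ (trivialSpecializations f q) = 0 := by
  have hex := exists_isNonsquareRoot hmonic hsq hdisc hcop hgenus
  exact ⟨finite_units_integer_quotient_square hS, hex,
    density_trivialSpecializations_eq_zero hmonic hS hδ hex⟩

theorem mainTheorem6 {K : Type*} [Field K] [NumberField K]
    (f : (𝓞 K)[X]) (hmonic : f.Monic) (hsq : Squarefree f)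
    (hodd : Odd f.natDegree) (hdeg : 3 ≤ f.natDegree)
    (S : Set (HeightOneSpectrum (𝓞 K))) (hS : S.Finite)
    (hPID : IsPrincipalIdealRing (S.integer K))
    (δ : Set (S.integer K) → ℝ) (hδ : IsDensity δ)
    (A B C : (S.integer K)[X])
    (hprim : (BinForm.mk A (2 * B) C).IsPrimitive)
    (hdisc : (BinForm.mk A (2 * B) C).disc = 4 * f.map (algebraMap (𝓞 K) (S.integer K)))
    (hcop : IsCoprime (A.map (algebraMap (S.integer K) K)) (f.map (algebraMap (𝓞 K) K)))
    (hgenus : ¬ BinForm.InPrincipalGenus (f.map (algebraMap (𝓞 K) K))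
      ((BinForm.mk A (2 * B) C).map (mapRingHom (algebraMap (S.integer K) K)))) :
    Finite ((S.integer K)ˣ ⧸ Subgroup.square (S.integer K)ˣ) ∧
    (∀ u : (S.integer K)ˣ, ∃ ρ : AlgebraicClosure K, IsNonsquareRoot f A u ρ) ∧
    ∀ (e : (S.integer K)ˣ ⧸ Subgroup.square (S.integer K)ˣ → (S.integer K)ˣ)
      (_ : ∀ ε, (QuotientGroup.mk (e ε) : (S.integer K)ˣ ⧸ Subgroup.square (S.integer K)ˣ) = ε)
      (ρ : (S.integer K)ˣ ⧸ Subgroup.square (S.integer K)ˣ → AlgebraicClosure K)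
      (_ : ∀ ε, IsNonsquareRoot f A (e ε) (ρ ε)),
      (∀ ε, Multipliable fun 𝔭 : inertPrimes A (e ε) (ρ ε) =>
        1 - 1 / (Ideal.absNorm 𝔭.1.asIdeal : ℝ)) ∧
      δ (trivialSpecializations f (BinForm.mk A (2 * B) C)) ≤
        ∑' ε, ∏' 𝔭 : inertPrimes A (e ε) (ρ ε), (1 - 1 / (Ideal.absNorm 𝔭.1.asIdeal : ℝ)) := by
  obtain ⟨hfin, hex, hzero⟩ := mainTheorem6_general hmonic hsq hS hδ hdisc hcop hgenus
  exact ⟨hfin, hex, fun e _ ρ _ =>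
    ⟨fun ε => multipliable_of_mem_Icc fun 𝔭 => one_sub_one_div_absNorm_mem_Icc 𝔭.1,
      hzero.trans_le <| tsum_nonneg fun ε =>
        tprod_nonneg fun 𝔭 => (one_sub_one_div_absNorm_mem_Icc 𝔭.1).1⟩⟩
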